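/- Let $p$ be a prime, $K/\mathbb{Q}_p$ a finite extension, $G_K$ its absolute Galois group, $I_K\subset G_K$ the inertia subgroup and $\mathrm{Frob}_K\in G_K$ a geometric Frobenius element. Let $F/\mathbb{Q}_p$ be a finite extension with ring of integers $\mathcal{O}$ and residue field $\mathbb{F}$, and let $X$ be an $\mathcal{O}[G_K]$-module, free of finite rank over $\mathcal{O}$, on which $G_K$ acts continuously for the $p$-adic topology. Suppose that there is a field $E$ with $\mathbb{Q}_p\subset E\subset F$ such that $X$ is realisable over $\mathcal{O}_E$ (i.e. $X\cong X_0\otimes_{\mathcal{O}_E}\mathcal{O}$ for an $\mathcal{O}_E[G_K]$-module $X_0$ finite free over $\mathcal{O}_E$) and such that the ramification index satisfies $e(F/E)>\mathrm{rank}_{\mathcal{O}}(X)$. Let $v_E$ be the valuation on $F$ taking the value $1$ on a uniformiser of $E$. Let $\psi:G_K\to\mathcal{O}^\times$ be a continuous unramified character (i.e. $\psi|_{I_K}=1$) with $0<v_E(\psi(\mathrm{Frob}_K)-1)<1/\mathrm{rank}_{\mathcal{O}}(X)$ (for $X=0$ the upper bound is only the requirement $\psi(\mathrm{Frob}_K)\neq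 1$). Let $\mathcal{O}(\psi)$ denote $\mathcal{O}$ with $G_K$ acting through $\psi$, put $X_\psi=X\otimes_{\mathcal{O}}\mathcal{O}(\psi)$, and assume that $X_\psi^{G_K}=0$. Then $\psi$ is trivial modulo the maximal ideal of $\mathcal{O}$, so that $X_\psi\otimes_{\mathcal{O}}\mathbb{F}=X\otimes_{\mathcal{O}}\mathbb{F}$ as $G_K$-modules. Let $$\delta^\vee: H^0(G_K, X_\psi\otimes_{\mathcal{O}}F/\mathcal{O})\to H^1(G_K,X\otimes_{\mathcal{O}}\mathbb{F})$$ be the connecting map of $0\to X_\psi\to X_\psi\otimes_{\mathcal{O}} F\to X_\psi\otimes_{\mathcal{O}} F/\mathcal{O}\to 0$ followed by reduction: an invariant element with lift $b\in X_\psi\otimes_{\mathcal{O}} F$ goes to the class of the continuous cocycle sending $g$ to the image of $gb-b\in X_\psi$ in $X\otimes_{\mathcal{O}}\mathbb{F}$. Then the image of $\delta^\vee$ is equal to the subspace of unramified classes $$H^1_{\mathrm{ur}}(G_K,X\otimes_{\mathcal{O}}\mathbb{F})=\ker\bigl(H^1(G_K,X\otimes_{\mathcal{O}}\mathbb{F})\to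 H^1(I_K,X\otimes_{\mathcal{O}}\mathbb{F})\bigr).$$ In particular this image depends only on the $G_K$-module $X\otimes_{\mathcal{O}}\mathbb{F}$, and not on $X$, $F$ or $\psi$: if $F',X',\psi'$ (with a suitable $E'$) satisfy the same hypotheses, then any $G_K$-equivariant isomorphism of abelian groups $X\otimes_{\mathcal{O}}\mathbb{F}\cong X'\otimes_{\mathcal{O}'}\mathbb{F}'$ carries the image of $\delta^\vee$ onto that of the map attached to $F',X',\psi'$. -/

import Mathlib

open scoped TensorProduct

noncomputable section

namespace GalTwist

/-! ### Continuous cohomology in degree one, with discrete coefficients -/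

section Cohomology

variable {R G M : Type*} [CommRing R] [Group G] [TopologicalSpace G] [AddCommGroup M] [Module R M]

/-- Continuous `1`-cocycles of `G` with values in the discrete module `M`
(continuous maps to a discrete space are the locally constant ones). -/
def Z1 (ρ : Representation R G M) : Submodule R (G → M) where
  carrier := {c | IsLocallyConstant c ∧ ∀ g h, c (g * h) = c g + ρ g (c h)}
  zero_mem' := ⟨IsLocallyConstant.const 0, fun g h => by simp⟩
  add_mem' := by
    rintro a b ⟨ha, ha'⟩ ⟨hb, hb'⟩
    refine ⟨ha.add hb, fun g h => ?_⟩
    simp only [Pi.add_apply, ha', hb', map_add]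
    abel
  smul_mem' := by
    rintro r a ⟨ha, ha'⟩
    refine ⟨ha.comp (fun m => r • m), fun g h => ?_⟩
    simp only [Pi.smul_apply, ha', map_smul, smul_add]

/-- The `1`-coboundaries `g ↦ g m - m`, inside the continuous `1`-cocycles. -/
def B1 (ρ : Representation R G M) : Submodule R (Z1 ρ) where
  carrier := {c | ∃ m : M, ∀ g, c.1 g = ρ g m - m}
  zero_mem' := ⟨0, fun g => by simp⟩
  add_mem' := by
    rintro a b ⟨m, hm⟩ ⟨n, hn⟩
    refine ⟨m + n, fun g => ?_⟩
    simp only [Submodule.coe_add, Pi.add_apply, hm, hn, map_add]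
    abel
  smul_mem' := by
    rintro r a ⟨m, hm⟩
    refine ⟨r • m, fun g => ?_⟩
    simp only [Submodule.coe_smul, Pi.smul_apply, hm, map_smul, smul_sub]

/-- `H¹(G, M)`. -/
abbrev H1 (ρ : Representation R G M) : Type _ := Z1 ρ ⧸ B1 ρ

/-- The action of a subgroup. -/
abbrev resRep (ρ : Representation R G M) (I : Subgroup G) : Representation R I M :=
  ρ.comp I.subtype

/-- Restriction of cocycles to a subgroup. -/
def Z1res (ρ : Representation R G M) (I : Subgroup G) : Z1 ρ →ₗ[R] Z1 (resRep ρ I) where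
  toFun c := ⟨fun g => c.1 g, c.2.1.comp_continuous continuous_subtype_val,
    fun g h => c.2.2 g h⟩
  map_add' _ _ := rfl
  map_smul' _ _ := rfl

/-- The restriction map `H¹(G, M) → H¹(I, M)`. -/
def H1res (ρ : Representation R G M) (I : Subgroup G) : H1 ρ →ₗ[R] H1 (resRep ρ I) :=
  Submodule.mapQ (B1 ρ) (B1 (resRep ρ I)) (Z1res ρ I) (by
    rintro c ⟨m, hm⟩
    exact ⟨m, fun g => hm g⟩)

section Functoriality

variable {R' M' : Type*} [CommRing R'] [AddCommGroup M'] [Module R' M']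

/-- The effect on cocycles of a `G`-equivariant additive map. -/
def Z1map (ρ : Representation R G M) (ρ' : Representation R' G M') (f : M →+ M')
    (hf : ∀ g m, f (ρ g m) = ρ' g (f m)) : Z1 ρ →+ Z1 ρ' where
  toFun c := ⟨fun g => f (c.1 g), c.2.1.comp f, fun g h => by
    change f (c.1 (g * h)) = f (c.1 g) + ρ' g (f (c.1 h))
    rw [c.2.2, map_add, hf]⟩
  map_zero' := Subtype.ext (funext fun _ => map_zero f)
  map_add' a b := Subtype.ext (funext fun g => map_add f (a.1 g) (b.1 g))

/-- The map `H¹(G, M) → H¹(G, M')` induced by a `G`-equivariant additive map `M → M'`. -/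
def H1map (ρ : Representation R G M) (ρ' : Representation R' G M') (f : M →+ M')
    (hf : ∀ g m, f (ρ g m) = ρ' g (f m)) : H1 ρ →+ H1 ρ' :=
  QuotientAddGroup.map (B1 ρ).toAddSubgroup (B1 ρ').toAddSubgroup (Z1map ρ ρ' f hf) (by
    rintro c ⟨m, hm⟩
    exact ⟨f m, fun g => by rw [← hf, ← map_sub, ← hm g]; rfl⟩)

end Functoriality

end Cohomology

/-! ### Connecting maps -/

section Connecting

variable {R G : Type*} [CommRing R] [Group G] [TopologicalSpace G]
  {A B C D : Type*} [AddCommGroup A] [Module R A] [AddCommGroup B] [Module R B]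
  [AddCommGroup C] [Module R C] [AddCommGroup D] [Module R D]

/-- A short exact sequence `0 → A → B → C → 0` of `R[G]`-modules (maps `i`, `q`) together with
an `R[G]`-linear map `r : A → D` to a discrete module `D`, such that the
cocycles `g ↦ r (i⁻¹ (g b - b))` arising from lifts `b` of invariants of `C` are continuous. -/
structure ConnectingData (ρA : Representation R G A) (ρB : Representation R G B)
    (ρC : Representation R G C) (ρD : Representation R G D)
    (i : A →ₗ[R] B) (q : B →ₗ[R] C) (r : A →ₗ[R] D) : Prop where
  i_equiv : ∀ g a, i (ρA g a) = ρB g (i a)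
  q_equiv : ∀ g b, q (ρB g b) = ρC g (q b)
  r_equiv : ∀ g a, r (ρA g a) = ρD g (r a)
  inj : Function.Injective i
  exact : Function.Exact i q
  surj : Function.Surjective q
  cont : ∀ (b : B) (c : G → A), (∀ g, i (c g) = ρB g b - b) → IsLocallyConstant fun g => r (c g)

namespace ConnectingData

variable {ρA : Representation R G A} {ρB : Representation R G B}
  {ρC : Representation R G C} {ρD : Representation R G D}
  {i : A →ₗ[R] B} {q : B →ₗ[R] C} {r : A →ₗ[R] D}

/-- The `A`-valued cocycle `g ↦ g b - b` attached to `b ∈ B` with `G`-invariant image in `C`. -/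
theorem exists_cochain (h : ConnectingData ρA ρB ρC ρD i q r) (b : B)
    (hb : q b ∈ ρC.invariants) (g : G) : ∃ a : A, i a = ρB g b - b :=
  (h.exact _).1 (by rw [map_sub, h.q_equiv, hb g, sub_self])

/-- The cocycle `g ↦ r (g b - b)`. -/
def cocycle (h : ConnectingData ρA ρB ρC ρD i q r) (b : B) (hb : q b ∈ ρC.invariants) :
    Z1 ρD :=
  ⟨fun g => r (h.exists_cochain b hb g).choose,
    h.cont b _ fun g => (h.exists_cochain b hb g).choose_spec,
    fun g k => by
      change r (h.exists_cochain b hb (g * k)).choose = r (h.exists_cochain b hb g).choose +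
        ρD g (r (h.exists_cochain b hb k).choose)
      rw [← h.r_equiv, ← map_add]
      congr 1
      apply h.inj
      rw [map_add, h.i_equiv, (h.exists_cochain b hb (g * k)).choose_spec,
        (h.exists_cochain b hb g).choose_spec, (h.exists_cochain b hb k).choose_spec,
        map_mul, map_sub]
      simp⟩

theorem cocycle_eq (h : ConnectingData ρA ρB ρC ρD i q r) (b : B) (hb : q b ∈ ρC.invariants)
    (g : G) (a : A) (ha : i a = ρB g b - b) : (h.cocycle b hb).1 g = r a := by
  change r _ = r a
  congr 1
  exact h.inj ((h.exists_cochain b hb g).choose_spec.trans ha.symm)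

theorem mk_cocycle_eq (h : ConnectingData ρA ρB ρC ρD i q r) (b b' : B)
    (hb : q b ∈ ρC.invariants) (hb' : q b' ∈ ρC.invariants) (e : q b = q b') :
    (Submodule.Quotient.mk (h.cocycle b hb) : H1 ρD) =
      Submodule.Quotient.mk (h.cocycle b' hb') := by
  rw [Submodule.Quotient.eq]
  obtain ⟨a, ha⟩ := (h.exact (b - b')).1 (by rw [map_sub, e, sub_self])
  refine ⟨r a, fun g => ?_⟩
  obtain ⟨u, hu⟩ := h.exists_cochain b hb g
  obtain ⟨v, hv⟩ := h.exists_cochain b' hb' g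
  change (h.cocycle b hb).1 g - (h.cocycle b' hb').1 g = _
  rw [h.cocycle_eq b hb g u hu, h.cocycle_eq b' hb' g v hv, ← h.r_equiv, ← map_sub, ← map_sub]
  congr 1
  apply h.inj
  rw [map_sub, map_sub, h.i_equiv, hu, hv, ha, map_sub]
  abel

/-- A lift to `B` of an element of `C`. -/
def lift (h : ConnectingData ρA ρB ρC ρD i q r) (x : C) : B := Function.surjInv h.surj x

theorem q_lift (h : ConnectingData ρA ρB ρC ρD i q r) (x : C) : q (h.lift x) = x :=
  Function.surjInv_eq h.surj x

theorem q_lift_mem (h : ConnectingData ρA ρB ρC ρD i q r) (x : ρC.invariants) :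
    q (h.lift x.1) ∈ ρC.invariants := by
  rw [h.q_lift]
  exact x.2

/-- The composite `H⁰(G, C) → H¹(G, A) → H¹(G, D)` of the connecting map with the map induced
by `r`: an invariant element of `C` with lift `b ∈ B` goes to the class of `g ↦ r (g b - b)`. -/
def delta (h : ConnectingData ρA ρB ρC ρD i q r) : ρC.invariants →ₗ[R] H1 ρD where
  toFun x := Submodule.Quotient.mk (h.cocycle (h.lift x.1) (h.q_lift_mem x))
  map_add' x y := by
    have e : q (h.lift x.1 + h.lift y.1) = (x + y).1 := by
      rw [map_add, h.q_lift, h.q_lift]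
      rfl
    have e' : q (h.lift x.1 + h.lift y.1) ∈ ρC.invariants := by
      rw [e]
      exact (x + y).2
    rw [← Submodule.Quotient.mk_add,
      h.mk_cocycle_eq _ (h.lift x.1 + h.lift y.1) (h.q_lift_mem (x + y)) e' (by rw [e, h.q_lift])]
    congr 1
    apply Subtype.ext
    funext g
    obtain ⟨u, hu⟩ := h.exists_cochain (h.lift x.1) (h.q_lift_mem x) g
    obtain ⟨v, hv⟩ := h.exists_cochain (h.lift y.1) (h.q_lift_mem y) g
    rw [Submodule.coe_add, Pi.add_apply, h.cocycle_eq _ _ g u hu, h.cocycle_eq _ _ g v hv,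
      h.cocycle_eq _ e' g (u + v) (by rw [map_add, hu, hv, map_add]; abel), map_add]
  map_smul' s x := by
    have e : q (s • h.lift x.1) = (s • x).1 := by
      rw [map_smul, h.q_lift]
      rfl
    have e' : q (s • h.lift x.1) ∈ ρC.invariants := by
      rw [e]
      exact (s • x).2
    rw [RingHom.id_apply, ← Submodule.Quotient.mk_smul,
      h.mk_cocycle_eq _ (s • h.lift x.1) (h.q_lift_mem (s • x)) e' (by rw [e, h.q_lift])]
    congr 1
    apply Subtype.ext
    funext g
    obtain ⟨u, hu⟩ := h.exists_cochain (h.lift x.1) (h.q_lift_mem x) g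
    rw [Submodule.coe_smul, Pi.smul_apply, h.cocycle_eq _ _ g u hu,
      h.cocycle_eq _ e' g (s • u) (by rw [map_smul, hu, map_smul, smul_sub]), map_smul]

theorem delta_eq (h : ConnectingData ρA ρB ρC ρD i q r) (x : ρC.invariants) (b : B)
    (hb : q b = x.1) :
    h.delta x = Submodule.Quotient.mk (h.cocycle b (by rw [hb]; exact x.2)) :=
  h.mk_cocycle_eq _ _ _ _ (by rw [h.q_lift, hb])

end ConnectingData

end Connecting

/-! ### Algebraic extensions of `ℚ_p` -/

section Fields

variable (p : ℕ) [Fact p.Prime]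

/-- The ring of integers of an algebraic extension `L` of `ℚ_p`: the elements of absolute value
at most `1`, for the unique extension to `L` of the `p`-adic absolute value. -/
def integers (L : Type*) [Field L] [Algebra ℚ_[p] L] [Algebra.IsAlgebraic ℚ_[p] L] :
    ValuationSubring L where
  carrier := {x | spectralNorm ℚ_[p] L x ≤ 1}
  mul_mem' {a b} ha hb := by
    have := map_mul (spectralMulAlgNorm ℚ_[p] L) a b
    simp only [spectralMulAlgNorm_def] at this
    change spectralNorm ℚ_[p] L (a * b) ≤ 1
    rw [this]
    exact mul_le_one₀ ha (spectralNorm_nonneg _) hb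
  one_mem' := spectralNorm_one.le
  add_mem' {a b} ha hb := (isNonarchimedean_spectralNorm a b).trans (max_le ha hb)
  zero_mem' := by
    change spectralNorm ℚ_[p] L 0 ≤ 1
    rw [spectralNorm_zero]
    exact zero_le_one
  neg_mem' {a} ha := by
    change spectralNorm ℚ_[p] L (-a) ≤ 1
    rw [spectralNorm_neg (Algebra.IsAlgebraic.isAlgebraic a)]
    exact ha
  mem_or_inv_mem' x := by
    have := map_inv₀ (spectralMulAlgNorm ℚ_[p] L) x
    simp only [spectralMulAlgNorm_def] at this
    change _ ≤ (1 : ℝ) ∨ spectralNorm ℚ_[p] L x⁻¹ ≤ 1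
    rw [this]
    exact (le_total _ 1).imp id fun h => inv_le_one_of_one_le₀ h

/-- The residue field of `L`. -/
abbrev resField (L : Type*) [Field L] [Algebra ℚ_[p] L] [Algebra.IsAlgebraic ℚ_[p] L] : Type _ :=
  IsLocalRing.ResidueField (integers p L)

/-- The ring of integers of `F` is an algebra over that of a subfield `E`. -/
instance integersAlgebra {F : Type*} [Field F] [Algebra ℚ_[p] F] [Algebra.IsAlgebraic ℚ_[p] F]
    (E : IntermediateField ℚ_[p] F) : Algebra (integers p E) (integers p F) :=
  (((algebraMap E F).comp (integers p E).subtype).codRestrict (integers p F) fun x => by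
    have h : spectralNorm ℚ_[p] E x.1 ≤ 1 := x.2
    rw [spectralNorm.eq_of_tower (K := ℚ_[p]) (E := E) (L := F)] at h
    exact h).toAlgebra

/-- The additive valuation on `F` with `v(ϖ) = 1`, for `ϖ` of absolute value in `(0, 1)`.
(The value at `0`, which is `∞` in the usual convention, is not used.) -/
def normalizedVal {F : Type*} [Field F] [Algebra ℚ_[p] F] (ϖ x : F) : ℝ :=
  Real.log (spectralNorm ℚ_[p] F x) / Real.log (spectralNorm ℚ_[p] F ϖ)

/-- The absolute Galois group, with its Krull topology. -/
abbrev absGal (K : Type*) [Field K] : Type _ := AlgebraicClosure K ≃ₐ[K] AlgebraicClosure K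

theorem spectralNorm_absGal (K : Type*) [Field K] [Algebra ℚ_[p] K] (σ : absGal K)
    (x : AlgebraicClosure K) :
    spectralNorm ℚ_[p] (AlgebraicClosure K) (σ x) = spectralNorm ℚ_[p] (AlgebraicClosure K) x :=
  (spectralNorm_eq_of_equiv (σ.restrictScalars ℚ_[p]) x).symm

variable (K : Type*) [Field K] [Algebra ℚ_[p] K] [Algebra.IsAlgebraic ℚ_[p] K]

theorem isAlgebraic_algebraicClosure : Algebra.IsAlgebraic ℚ_[p] (AlgebraicClosure K) :=
  Algebra.IsAlgebraic.trans ℚ_[p] K (AlgebraicClosure K)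

/-- The inertia subgroup `I_K`: the automorphisms inducing the identity on the residue field
of the algebraic closure of `K`. -/
def inertia : Subgroup (absGal K) where
  carrier := {σ | ∀ x : AlgebraicClosure K, spectralNorm ℚ_[p] (AlgebraicClosure K) x ≤ 1 →
    spectralNorm ℚ_[p] (AlgebraicClosure K) (σ x - x) < 1}
  one_mem' x _ := by simp [spectralNorm_zero]
  mul_mem' {σ τ} hσ hτ x hx := by
    have := isAlgebraic_algebraicClosure p K
    have h1 := hσ (τ x) (by rw [spectralNorm_absGal]; exact hx)
    have h2 := hτ x hx
    have h3 := isNonarchimedean_spectralNorm (K := ℚ_[p]) (σ (τ x) - τ x) (τ x - x)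
    rw [sub_add_sub_cancel] at h3
    exact h3.trans_lt (max_lt h1 h2)
  inv_mem' {σ} hσ x hx := by
    have := isAlgebraic_algebraicClosure p K
    have h1 := hσ (σ⁻¹ x) (by rw [spectralNorm_absGal]; exact hx)
    rw [← spectralNorm_neg (Algebra.IsAlgebraic.isAlgebraic _), neg_sub] at h1
    have e : σ (σ⁻¹ x) = x := σ.apply_symm_apply x
    rwa [e] at h1

/-- `σ` is a geometric Frobenius element: its inverse induces `x ↦ x ^ q` on the
residue field of the algebraic closure, where `q` is the order of the residue field of `K`. -/
def IsGeomFrob (σ : absGal K) : Prop :=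
  ∀ x : AlgebraicClosure K, spectralNorm ℚ_[p] (AlgebraicClosure K) x ≤ 1 →
    spectralNorm ℚ_[p] (AlgebraicClosure K) (σ⁻¹ x - x ^ Nat.card (resField p K)) < 1

end Fields

/-! ### Representations over rings of integers -/

section Representations

/-- Continuity of a representation, for the `p`-adic topology on the module. -/
def IsContRep (p : ℕ) {R G X : Type*} [CommRing R] [Group G] [TopologicalSpace G]
    [AddCommGroup X] [Module R X] (ρ : Representation R G X) : Prop :=
  letI : TopologicalSpace X := (Ideal.span {(p : R)}).adicModuleTopology X
  Continuous fun z : G × X => ρ z.1 z.2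

/-- The free module of rank one `R(ψ)` on which `G` acts through the character `ψ`. -/
def charRep {R G : Type*} [CommRing R] [Group G] (ψ : G →* Rˣ) : Representation R G R where
  toFun g := LinearMap.lsmul R R (ψ g : R)
  map_one' := by ext; simp
  map_mul' g h := by ext; simp

/-- The representation `X ⊗ R(ψ)`. -/
abbrev twist {R G X : Type*} [CommRing R] [Group G] [AddCommGroup X] [Module R X]
    (ρ : Representation R G X) (ψ : G →* Rˣ) : Representation R G (X ⊗[R] R) :=
  ρ.tprod (charRep ψ)

/-- The representation `X ⊗ N`, where `G` acts trivially on the `R`-module `N`. -/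
abbrev tensorTriv {R G X : Type*} [CommRing R] [Group G] [AddCommGroup X] [Module R X]
    (ρ : Representation R G X) (N : Type*) [AddCommGroup N] [Module R N] :
    Representation R G (X ⊗[R] N) :=
  ρ.tprod (Representation.trivial R G N)

/-- `X` is realisable over `S → R`: it is the extension of scalars of a representation of `G` on
a finite free `S`-module. -/
def IsRealisableOver (S : Type*) {R G X : Type*} [CommRing S] [CommRing R] [Algebra S R] [Group G]
    [AddCommGroup X] [Module R X] (ρ : Representation R G X) : Prop :=
  ∃ (n : ℕ) (ρ₀ : Representation S G (Fin n → S)) (e : (R ⊗[S] (Fin n → S)) ≃ₗ[R] X),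
    ∀ g a x, e (a ⊗ₜ[S] ρ₀ g x) = ρ g (e (a ⊗ₜ[S] x))

theorem IsContRep.eventually {p : ℕ} {R G X : Type*} [CommRing R] [Group G] [TopologicalSpace G]
    [AddCommGroup X] [Module R X] {ρ : Representation R G X} (h : IsContRep p ρ) (x : X) (m : ℕ)
    (g₀ : G) : ∀ᶠ g in nhds g₀, ∃ y : X, ρ g x - ρ g₀ x = (p : R) ^ m • y := by
  let J := Ideal.span {(p : R)}
  let _ : TopologicalSpace R := J.adic_basis.topology
  let _ : TopologicalSpace X := J.adicModuleTopology X
  have hc : Continuous fun z : G × X => ρ z.1 z.2 := h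
  have hc' : Continuous fun g : G => ρ g x := hc.comp (Continuous.prodMk_left x)
  have hmem : {y : X | y - ρ g₀ x ∈ J ^ m • (⊤ : Submodule R X)} ∈ nhds (ρ g₀ x) := by
    have hb := (J.ringFilterBasis.moduleFilterBasis
      (J.adic_module_basis X)).toAddGroupFilterBasis.nhds_hasBasis (ρ g₀ x)
    refine hb.mem_iff.2 ⟨(J ^ m • (⊤ : Submodule R X) : Submodule R X), ⟨m, rfl⟩, ?_⟩
    rintro _ ⟨y, hy, rfl⟩
    simpa using hy
  filter_upwards [hc'.continuousAt.preimage_mem_nhds hmem] with g hg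
  have hg' : ρ g x - ρ g₀ x ∈ J ^ m • (⊤ : Submodule R X) := hg
  rw [Ideal.span_singleton_pow, Submodule.ideal_span_singleton_smul] at hg'
  obtain ⟨y, -, hy⟩ := Submodule.mem_smul_pointwise_iff_exists _ _ _ |>.1 hg'
  exact ⟨y, hy.symm⟩

end Representations

/-! ### The map from `H⁰(G, X(ψ) ⊗ F/O)` to `H¹(G, X ⊗ 𝔽)` -/

section DeltaDual

variable (p : ℕ) [Fact p.Prime]
  {F : Type*} [Field F] [Algebra ℚ_[p] F] [FiniteDimensional ℚ_[p] F]

/-- The `O`-module `F/O`. -/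
abbrev FmodO (F : Type*) [Field F] [Algebra ℚ_[p] F] [FiniteDimensional ℚ_[p] F] : Type _ :=
  F ⧸ LinearMap.range (Algebra.linearMap (integers p F) F)

variable {G X : Type*} [Group G] [TopologicalSpace G] [AddCommGroup X] [Module (integers p F) X]

theorem exists_pow_smul (f : F) : ∃ (n : ℕ) (a : integers p F), (p : F) ^ n * f = a := by
  have hp : spectralNorm ℚ_[p] F (p : F) < 1 := by
    have := spectralNorm_extends (K := ℚ_[p]) (L := F) (p : ℚ_[p])
    rw [map_natCast] at this
    rw [this]
    exact Padic.norm_p_lt_one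
  have hlim := (tendsto_pow_atTop_nhds_zero_of_lt_one (spectralNorm_nonneg (p : F)) hp).mul_const
    (spectralNorm ℚ_[p] F f)
  rw [zero_mul] at hlim
  obtain ⟨n, hn⟩ := (hlim.eventually_le_const zero_lt_one).exists
  refine ⟨n, ⟨(p : F) ^ n * f, ?_⟩, rfl⟩
  have h1 := map_mul (spectralMulAlgNorm ℚ_[p] F) ((p : F) ^ n) f
  rw [map_pow] at h1
  simp only [spectralMulAlgNorm_def] at h1
  change spectralNorm ℚ_[p] F _ ≤ 1
  rw [h1]
  exact hn

/-- The inclusion of `X(ψ)` into `X(ψ) ⊗ F`. -/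
def toF (A : Type*) [AddCommGroup A] [Module (integers p F) A] :
    A →ₗ[integers p F] A ⊗[integers p F] F :=
  (TensorProduct.mk (integers p F) A F).flip 1

/-- The projection of `X(ψ) ⊗ F` onto `X(ψ) ⊗ F/O`. -/
def toFmodO (A : Type*) [AddCommGroup A] [Module (integers p F) A] :
    A ⊗[integers p F] F →ₗ[integers p F] A ⊗[integers p F] FmodO p F :=
  LinearMap.lTensor A (Submodule.mkQ _)

/-- The reduction map from the module `X ⊗ O` underlying `X(ψ)` to `X ⊗ 𝔽`. -/
def reduction (X : Type*) [AddCommGroup X] [Module (integers p F) X] :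
    X ⊗[integers p F] (integers p F) →ₗ[integers p F] X ⊗[integers p F] resField p F :=
  LinearMap.lTensor X (Algebra.linearMap _ _)

variable {p}

theorem twist_eventually {ρ : Representation (integers p F) G X} {ψ : G →* (integers p F)ˣ}
    (hρ : IsContRep p ρ) (hψ : IsContRep p (charRep ψ)) (a : X ⊗[integers p F] (integers p F))
    (m : ℕ) (g₀ : G) :
    ∀ᶠ g in nhds g₀, ∃ y, twist ρ ψ g a - twist ρ ψ g₀ a = (p : integers p F) ^ m • y := by
  induction a with
  | zero => exact .of_forall fun g => ⟨0, by simp⟩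
  | add a b ha hb =>
    filter_upwards [ha, hb] with g hg hg'
    obtain ⟨y, hy⟩ := hg
    obtain ⟨z, hz⟩ := hg'
    refine ⟨y + z, ?_⟩
    rw [smul_add, ← hy, ← hz, map_add, map_add]
    abel
  | tmul x s =>
    filter_upwards [hρ.eventually x m g₀, hψ.eventually s m g₀] with g hg hg'
    obtain ⟨y, hy⟩ := hg
    obtain ⟨z, hz⟩ := hg'
    refine ⟨y ⊗ₜ charRep ψ g s + ρ g₀ x ⊗ₜ z, ?_⟩
    rw [smul_add, TensorProduct.smul_tmul', ← hy, ← TensorProduct.tmul_smul, ← hz,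
      TensorProduct.sub_tmul, TensorProduct.tmul_sub]
    simp [Representation.tprod_apply]

theorem exists_pow_smul_tensor {A : Type*} [AddCommGroup A] [Module (integers p F) A]
    (b : A ⊗[integers p F] F) : ∃ (n : ℕ) (a : A), (p : integers p F) ^ n • b = toF p A a := by
  induction b with
  | zero => exact ⟨0, 0, by simp⟩
  | add b c hb hc =>
    obtain ⟨n, a, ha⟩ := hb
    obtain ⟨m, d, hd⟩ := hc
    refine ⟨n + m, (p : integers p F) ^ m • a + (p : integers p F) ^ n • d, ?_⟩
    rw [map_add, map_smul, map_smul, ← ha, ← hd, smul_add, smul_smul, smul_smul, ← pow_add,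
      ← pow_add, add_comm m n]
  | tmul x f =>
    obtain ⟨n, a, ha⟩ := exists_pow_smul p f
    refine ⟨n, a • x, ?_⟩
    have e : (p : integers p F) ^ n • f = a • (1 : F) := by
      rw [Algebra.smul_def, Algebra.smul_def, mul_one, map_pow, map_natCast, ha]
      rfl
    change _ = (a • x) ⊗ₜ[integers p F] (1 : F)
    rw [← TensorProduct.tmul_smul, e, TensorProduct.tmul_smul, TensorProduct.smul_tmul']

theorem toF_eq (A : Type*) [AddCommGroup A] [Module (integers p F) A] (a : A) :
    toF p A a = LinearMap.lTensor A (Algebra.linearMap (integers p F) F)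
      ((TensorProduct.rid (integers p F) A).symm a) := by
  simp [toF]

theorem toF_injective (A : Type*) [AddCommGroup A] [Module (integers p F) A]
    [Module.Flat (integers p F) A] : Function.Injective (toF p (F := F) A) := by
  have h : Function.Injective (Algebra.linearMap (integers p F) F) := Subtype.val_injective
  have h' := Module.Flat.lTensor_preserves_injective_linearMap (M := A) _ h
  intro a b hab
  rw [toF_eq, toF_eq] at hab
  exact (TensorProduct.rid (integers p F) A).symm.injective (h' hab)

theorem toF_exact (A : Type*) [AddCommGroup A] [Module (integers p F) A] :
    Function.Exact (toF p (F := F) A) (toFmodO p A) := by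
  have h : Function.Exact (Algebra.linearMap (integers p F) F)
      (LinearMap.range (Algebra.linearMap (integers p F) F)).mkQ :=
    LinearMap.exact_map_mkQ_range _
  have h' := lTensor_exact A h (Submodule.mkQ_surjective _)
  intro b
  refine (h' b).trans ⟨?_, ?_⟩
  · rintro ⟨c, rfl⟩
    refine ⟨TensorProduct.rid (integers p F) A c, ?_⟩
    rw [toF_eq, LinearEquiv.symm_apply_apply]
  · rintro ⟨a, rfl⟩
    exact ⟨_, (toF_eq A a).symm⟩

theorem natCast_prime_resField :
    (algebraMap (integers p F) (resField p F)) (p : integers p F) = 0 := by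
  change IsLocalRing.residue _ _ = 0
  rw [IsLocalRing.residue_eq_zero_iff, IsLocalRing.mem_maximalIdeal, mem_nonunits_iff]
  rintro ⟨u, hu⟩
  have h1 : spectralNorm ℚ_[p] F ((u⁻¹ : (integers p F)ˣ) : integers p F).1 ≤ 1 :=
    ((u⁻¹ : (integers p F)ˣ) : integers p F).2
  have h2 : (p : F) * ((u⁻¹ : (integers p F)ˣ) : integers p F).1 = 1 := by
    have := congrArg Subtype.val (u.mul_inv)
    rw [hu] at this
    exact this
  have hp : spectralNorm ℚ_[p] F (p : F) < 1 := by
    have := spectralNorm_extends (K := ℚ_[p]) (L := F) (p : ℚ_[p])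
    rw [map_natCast] at this
    rw [this]
    exact Padic.norm_p_lt_one
  have h3 := map_mul (spectralMulAlgNorm ℚ_[p] F) (p : F)
    ((u⁻¹ : (integers p F)ˣ) : integers p F).1
  rw [h2] at h3
  simp only [spectralMulAlgNorm_def, spectralNorm_one] at h3
  have := mul_lt_one_of_nonneg_of_lt_one_left (spectralNorm_nonneg (p : F)) hp h1
  linarith

theorem reduction_smul_eq_zero (a : X ⊗[integers p F] (integers p F)) :
    reduction p X ((p : integers p F) • a) = 0 := by
  rw [map_smul]
  induction reduction p X a with
  | zero => simp
  | add b c hb hc => rw [smul_add, hb, hc, add_zero]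
  | tmul x f =>
    rw [← TensorProduct.tmul_smul, Algebra.smul_def, natCast_prime_resField, zero_mul,
      TensorProduct.tmul_zero]

variable [Module.Free (integers p F) X]

/-- The exact sequence `0 → X(ψ) → X(ψ) ⊗ F → X(ψ) ⊗ F/O → 0` and the reduction map
`X(ψ) → X(ψ) ⊗ 𝔽 = X ⊗ 𝔽`, which is equivariant as `ψ` is residually trivial. -/
theorem connectingData {ρ : Representation (integers p F) G X} {ψ : G →* (integers p F)ˣ}
    (hρ : IsContRep p ρ) (hψ : IsContRep p (charRep ψ))
    (hres : ∀ g, IsLocalRing.residue (integers p F) (ψ g) = 1) :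
    ConnectingData (twist ρ ψ) (tensorTriv (twist ρ ψ) F) (tensorTriv (twist ρ ψ) (FmodO p F))
      (tensorTriv ρ (resField p F)) (toF p _) (toFmodO p _) (reduction p X) where
  i_equiv g a := by simp [toF]
  q_equiv g b := by
    induction b with
    | zero => simp
    | add b c hb hc => simp only [map_add, hb, hc]
    | tmul x f => simp [toFmodO]
  r_equiv g a := by
    induction a with
    | zero => simp
    | add b c hb hc => simp only [map_add, hb, hc]
    | tmul x s =>
      simp [reduction, charRep, hres g]
  inj := toF_injective _
  exact := toF_exact _
  surj := LinearMap.lTensor_surjective _ (Submodule.mkQ_surjective _)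
  cont b c hc := by
    obtain ⟨n, a, ha⟩ := exists_pow_smul_tensor b
    have key : ∀ g, (p : integers p F) ^ n • c g = twist ρ ψ g a - a := fun g => by
      apply toF_injective (p := p) (F := F)
      have e : toF p _ (twist ρ ψ g a) = tensorTriv (twist ρ ψ) F g (toF p _ a) := by simp [toF]
      rw [map_smul, hc, map_sub, e, ← ha, map_smul, smul_sub]
    refine (IsLocallyConstant.iff_eventually_eq _).2 fun g₀ => ?_
    filter_upwards [twist_eventually hρ hψ a (n + 1) g₀] with g hg
    obtain ⟨y, hy⟩ := hg
    have hp0 : (p : integers p F) ^ n ≠ 0 := by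
      refine pow_ne_zero _ fun h => ?_
      have h' : ((p : integers p F) : F) = 0 := by rw [h]; rfl
      have : CharZero F := charZero_of_injective_algebraMap (algebraMap ℚ_[p] F).injective
      have h'' : (p : F) = 0 := h'
      exact (Fact.out : p.Prime).ne_zero (Nat.cast_eq_zero.1 h'')
    have e : c g - c g₀ = (p : integers p F) • y := by
      apply smul_right_injective _ hp0
      change _ • _ = _ • _
      rw [smul_sub, key, key, smul_smul, ← pow_succ, ← hy]
      abel
    rw [← sub_eq_zero, ← map_sub, e, reduction_smul_eq_zero]

/-- The map `H⁰(G, X(ψ) ⊗ F/O) → H¹(G, X ⊗ 𝔽)`: the connecting map of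
`0 → X(ψ) → X(ψ) ⊗ F → X(ψ) ⊗ F/O → 0` followed by reduction, for a residually trivial
character `ψ`. -/
def deltaDual {ρ : Representation (integers p F) G X} {ψ : G →* (integers p F)ˣ}
    (hρ : IsContRep p ρ) (hψ : IsContRep p (charRep ψ))
    (hres : ∀ g, IsLocalRing.residue (integers p F) (ψ g) = 1) :
    (tensorTriv (twist ρ ψ) (FmodO p F)).invariants →ₗ[integers p F]
      H1 (tensorTriv ρ (resField p F)) :=
  (connectingData hρ hψ hres).delta

end DeltaDual

/-- The subspace `H¹_ur(G_K, M)` of unramified classes: the kernel of restriction to `I_K`. -/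
def H1ur (p : ℕ) [Fact p.Prime] {K : Type*} [Field K] [Algebra ℚ_[p] K]
    [Algebra.IsAlgebraic ℚ_[p] K] {R M : Type*} [CommRing R] [AddCommGroup M] [Module R M]
    (ρ : Representation R (absGal K) M) : Submodule R (H1 ρ) :=
  LinearMap.ker (H1res ρ (inertia p K))

end GalTwist

end

open scoped TensorProduct

noncomputable section

namespace GalTwist

/-! ### Linear algebra over a base change -/

section BaseChange

/-! Write `Φ` for the Frobenius, `u = ψ Φ`, `π` for a uniformiser of `E`, and `n` for the rank of
`X`. Everything rests on the size of `u ρ(Φ) - 1`. The characteristic polynomial `Q` of `ρ(Φ) - 1`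
has coefficients in the integers of `E`, so modulo `π` it is `X ^ j` times a polynomial with nonzero
constant term, with `j ≤ n`. As `μ = u⁻¹ - 1` has valuation strictly between `0` and `1/n`, the
value `Q(μ)` is not divisible by `π`. By Cayley-Hamilton, `u ρ(Φ) - 1` therefore divides a scalar
`c` with `π = c m` and `m` in the maximal ideal; the cofactor `T` is a polynomial in `ρ(Φ)`
(`exists_aeval_mul_eq_smul`).

Realisability enters a second time: modulo an ideal `J` containing `π`, `X` is a base change from
the residue field of `E`, hence a flat one, so inertia invariants modulo `J` lift to inertia
invariants modulo `π` (`exists_sub_mem_forall_eq_smul`).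

Image inside unramified classes (`range_deltaDual_le`): if `b` is invariant modulo `X(ψ)`, then `c b
= T(Φb - b)` is integral and inertia-invariant modulo `c`. Correcting it by some `c y` makes it
invariant modulo `π = c m`; dividing by `c`, the cocycle on inertia is the coboundary of `y` modulo
`m`.

Unramified classes inside the image (`H1ur_le_range_deltaDual`): normalise the cocycle to vanish on
inertia, lift its value at `Φ` to `x`, inertia-invariant modulo `π`, and take `b = T x / c`. Then
`Φb - b = x`, while `gb - b` is divisible by `m` for `g` in inertia.

To pass from inertia and `Φ` to the whole group, `eq_top_of_isOpen` shows that these generate it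
topologically. Independence of the choices follows because unramified classes are functorial
(`H1ur_map_eq`). -/

theorem mem_ideal_smul_top_iff {R X : Type*} [CommRing R] [AddCommGroup X] [Module R X] {n : ℕ}
    (e : X ≃ₗ[R] (Fin n → R)) (J : Ideal R) (x : X) :
    x ∈ J • (⊤ : Submodule R X) ↔ ∀ i, e x i ∈ J := by
  constructor
  · intro hx i
    induction hx using Submodule.smul_induction_on' with
    | smul r hr y _ =>
      rw [map_smul, Pi.smul_apply, smul_eq_mul]
      exact J.mul_mem_right _ hr
    | add y _ z _ hy hz =>
      rw [map_add, Pi.add_apply]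
      exact J.add_mem hy hz
  · intro h
    have hx : x = ∑ i, e x i • e.symm (Pi.single i 1) := by
      apply e.injective
      rw [map_sum]
      simp only [map_smul, LinearEquiv.apply_symm_apply]
      exact pi_eq_sum_univ' (e x)
    rw [hx]
    exact Submodule.sum_mem _ fun i _ => Submodule.smul_mem_smul (h i) trivial

/-- Let `X` be the extension of scalars to `R` of a free `S`-module, with endomorphisms `h i`
coming from `S`, and let `π` generate a maximal ideal of `S`. For an ideal `J` containing `π`, the
elements killed by all `h i` modulo `J` lift to elements killed by all `h i` modulo `π`. -/
theorem exists_sub_mem_forall_eq_smul {S R X ι : Type*} [CommRing S] [CommRing R] [Algebra S R]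
    [AddCommGroup X] [Module R X] {n : ℕ} {π : S} (hπ : (Ideal.span {π}).IsMaximal)
    {J : Ideal R} (hJ : algebraMap S R π ∈ J) (e : (R ⊗[S] (Fin n → S)) ≃ₗ[R] X)
    (f : ι → Module.End S (Fin n → S)) (h : ι → Module.End R X)
    (hfh : ∀ i a x, e (a ⊗ₜ[S] f i x) = h i (e (a ⊗ₜ[S] x)))
    (a : X) (ha : ∀ i, h i a ∈ J • (⊤ : Submodule R X)) :
    ∃ a', a - a' ∈ J • (⊤ : Submodule R X) ∧ ∀ i, ∃ z, h i a' = algebraMap S R π • z := by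
  classical
  let E : X ≃ₗ[R] (Fin n → R) := e.symm.trans (TensorProduct.piScalarRight S R R (Fin n))
  have hE : ∀ r x i, E (e (r ⊗ₜ[S] x)) i = x i • r := fun r x i => by simp [E]
  let k := S ⧸ Ideal.span {π}
  let _ : Field k := Ideal.Quotient.field _
  let φ : k →+* R ⧸ J := Ideal.Quotient.lift _ ((Ideal.Quotient.mk J).comp (algebraMap S R)) (by
    intro s hs
    obtain ⟨t, rfl⟩ := Ideal.mem_span_singleton'.1 hs
    rw [RingHom.comp_apply, Ideal.Quotient.eq_zero_iff_mem, map_mul]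
    exact J.mul_mem_left _ hJ)
  let _ : Algebra k (R ⧸ J) := φ.toAlgebra
  have hsmul : ∀ (s : S) (r : R), (Ideal.Quotient.mk _ s : k) • Ideal.Quotient.mk J r =
      Ideal.Quotient.mk J (s • r) := fun s r => by
    rw [Algebra.smul_def, Algebra.smul_def, map_mul]
    rfl
  -- The coordinates of `a` modulo `J` span a finite-dimensional `k`-space. Expanding them in a
  -- basis lifted to `b j` gives `a ≡ ∑ b j ⊗ u j`, with vectors `u j` over `S` and the `b j`
  -- independent over `k`.
  let W : Submodule k (R ⧸ J) := Submodule.span k (Set.range fun i => Ideal.Quotient.mk J (E a i))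
  have hW : FiniteDimensional k W := FiniteDimensional.span_of_finite k (Set.finite_range _)
  let β := Module.finBasis k W
  choose b hb using fun j => Ideal.Quotient.mk_surjective (β j).1
  choose u hu using fun i j => Ideal.Quotient.mk_surjective
    (β.repr ⟨_, Submodule.subset_span ⟨i, rfl⟩⟩ j)
  have hind : LinearIndependent k fun j => Ideal.Quotient.mk J (b j) := by
    simp_rw [hb]
    exact β.linearIndependent.map' W.subtype W.ker_subtype
  let a' : X := ∑ j, e (b j ⊗ₜ[S] fun i => u i j)
  have haa' : a - a' ∈ J • (⊤ : Submodule R X) := by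
    rw [mem_ideal_smul_top_iff E]
    intro i
    rw [← Ideal.Quotient.eq_zero_iff_mem, map_sub, Pi.sub_apply, map_sub, sub_eq_zero, map_sum,
      Finset.sum_apply, map_sum]
    simp_rw [hE, ← hsmul, hu, hb]
    have := congrArg Subtype.val
      (β.sum_repr ⟨Ideal.Quotient.mk J (E a i), Submodule.subset_span ⟨i, rfl⟩⟩)
    rw [Submodule.coe_sum] at this
    exact this.symm
  refine ⟨a', haa', fun g => ?_⟩
  have h1 : h g a' ∈ J • (⊤ : Submodule R X) := by
    have h2 : h g (a - a') ∈ J • (⊤ : Submodule R X) :=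
      Submodule.smul_top_le_comap_smul_top J (h g) haa'
    have := Submodule.sub_mem _ (ha g) h2
    rwa [map_sub, sub_sub_cancel] at this
  have h2 : h g a' = ∑ j, e (b j ⊗ₜ[S] f g fun i => u i j) := by
    simp only [a', map_sum, hfh]
  -- Since `f g` acts only on the `S`-vectors, independence of the `b j` turns vanishing modulo `J`
  -- into vanishing of each term modulo `π`.
  have h3 : ∀ j i, π ∣ f g (fun i => u i j) i := fun j i => by
    have h4 := (mem_ideal_smul_top_iff E J _).1 h1 i
    rw [← Ideal.Quotient.eq_zero_iff_mem, h2, map_sum, Finset.sum_apply, map_sum] at h4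
    simp_rw [hE, ← hsmul] at h4
    have h5 := Fintype.linearIndependent_iff.1 hind _ h4 j
    rwa [Ideal.Quotient.eq_zero_iff_mem, Ideal.mem_span_singleton] at h5
  choose w hw using h3
  refine ⟨∑ j, e (b j ⊗ₜ[S] w j), ?_⟩
  rw [h2, Finset.smul_sum]
  refine Finset.sum_congr rfl fun j _ => ?_
  rw [← map_smul, algebraMap_smul, ← TensorProduct.tmul_smul]
  congr 2
  funext i
  exact hw j i

end BaseChange

/-! ### Values of monic polynomials at elements of small positive valuation -/

/-- If `π` generates a maximal ideal of `S` and divides the value of a monic polynomial over `S`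
at an element `μ` of the maximal ideal of `R`, then it divides `μ ^ n`, where `n` is the degree. -/
theorem dvd_pow_of_dvd_aeval {S R : Type*} [CommRing S] [CommRing R] [IsLocalRing R] [Algebra S R]
    {π : S} (hπ : (Ideal.span {π}).IsMaximal)
    {Q : Polynomial S} (hQ : Q.Monic) {μ : R} (hμ : μ ∈ IsLocalRing.maximalIdeal R)
    (hdvd : algebraMap S R π ∣ Polynomial.aeval μ Q) :
    algebraMap S R π ∣ μ ^ Q.natDegree := by
  let k := S ⧸ Ideal.span {π}
  let _ : Field k := Ideal.Quotient.field _
  let J : Ideal R := Ideal.span {algebraMap S R π}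
  let φ : k →+* R ⧸ J := Ideal.Quotient.lift _ ((Ideal.Quotient.mk J).comp (algebraMap S R)) (by
    intro s hs
    obtain ⟨t, rfl⟩ := Ideal.mem_span_singleton'.1 hs
    rw [RingHom.comp_apply, Ideal.Quotient.eq_zero_iff_mem, map_mul]
    exact J.mul_mem_left _ (Ideal.mem_span_singleton_self _))
  have hφ : φ.comp (Ideal.Quotient.mk _) = (Ideal.Quotient.mk J).comp (algebraMap S R) :=
    Ideal.Quotient.lift_comp_mk _ _ _
  let q : Polynomial k := Q.map (Ideal.Quotient.mk _)
  have hq : q.Monic := hQ.map _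
  have hq0 : q.eval₂ φ (Ideal.Quotient.mk J μ) = 0 := by
    rw [Polynomial.eval₂_map, hφ, ← Polynomial.hom_eval₂, Ideal.Quotient.eq_zero_iff_mem,
      Ideal.mem_span_singleton]
    exact hdvd
  -- Split off the zero at `0`. The cofactor `s` has nonzero constant term in the field `k`, so its
  -- value at `μ`, an element of the maximal ideal, is a unit; thus only the power of `μ` can vanish
  -- modulo `π`.
  obtain ⟨s, hs, hs'⟩ := q.exists_eq_pow_rootMultiplicity_mul_and_not_dvd hq.ne_zero 0
  have hunit : IsUnit (s.eval₂ φ (Ideal.Quotient.mk J μ)) := by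
    have h0 : s.coeff 0 ≠ 0 := fun h => hs' (by
      rw [map_zero, sub_zero]
      exact Polynomial.X_dvd_iff.2 h)
    rw [← s.divX_mul_X_add, Polynomial.eval₂_add, Polynomial.eval₂_mul, Polynomial.eval₂_X,
      Polynomial.eval₂_C]
    obtain ⟨d, hd⟩ := Ideal.Quotient.mk_surjective (s.divX.eval₂ φ (Ideal.Quotient.mk J μ))
    obtain ⟨v, hv⟩ := Ideal.Quotient.mk_surjective (φ (s.coeff 0))
    obtain ⟨v', hv'⟩ := Ideal.Quotient.mk_surjective (φ (s.coeff 0)⁻¹)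
    rw [← hd, ← hv, ← map_mul, ← map_add]
    -- The residual argument needs `J` inside the maximal ideal; in the zero ring every element is a
    -- unit.
    by_cases hJ : J = ⊤
    · have : Subsingleton (R ⧸ J) := Ideal.Quotient.subsingleton_iff.2 hJ
      exact isUnit_of_subsingleton _
    refine IsUnit.map _ ?_
    by_contra hnon
    have h1 : v ∈ IsLocalRing.maximalIdeal R := by
      have := Ideal.sub_mem _ ((IsLocalRing.mem_maximalIdeal _).2 hnon)
        (Ideal.mul_mem_left _ d hμ)
      rwa [add_sub_cancel_left] at this
    have h2 : v' * v - 1 ∈ J := by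
      rw [← Ideal.Quotient.eq_zero_iff_mem, map_sub, map_mul, hv, hv', ← map_mul,
        inv_mul_cancel₀ h0, map_one, map_one, sub_self]
    have h3 := Ideal.sub_mem _ (Ideal.mul_mem_left _ v' h1) (IsLocalRing.le_maximalIdeal hJ h2)
    rw [sub_sub_cancel] at h3
    exact (Ideal.ne_top_iff_one _).1 (IsLocalRing.maximalIdeal.isMaximal R).ne_top h3
  have hpow : Ideal.Quotient.mk J μ ^ q.rootMultiplicity 0 = 0 := by
    rw [hs, Polynomial.eval₂_mul] at hq0
    have := hunit.mul_left_eq_zero.1 hq0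
    rw [Polynomial.eval₂_pow] at this
    simpa using this
  have hle : q.rootMultiplicity 0 ≤ Q.natDegree :=
    calc q.rootMultiplicity 0 = ((Polynomial.X - Polynomial.C 0 : Polynomial k) ^
          q.rootMultiplicity 0).natDegree := by
            rw [Polynomial.natDegree_pow, Polynomial.natDegree_X_sub_C, mul_one]
      _ ≤ q.natDegree := Polynomial.natDegree_le_of_dvd ⟨s, hs⟩ hq.ne_zero
      _ = Q.natDegree := hQ.natDegree_map _
  rw [← map_pow, Ideal.Quotient.eq_zero_iff_mem, Ideal.mem_span_singleton] at hpow
  exact hpow.trans (pow_dvd_pow _ hle)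

/-- Let the endomorphism `Φ` of `X` be defined over `S`. For a unit `u` close to `1`, but not
too close, the endomorphism `u Φ - 1` divides a scalar `c` that is not divisible by `π`, and the
cofactor is a polynomial in `Φ`. -/
theorem exists_aeval_mul_eq_smul {S R X : Type*} [CommRing S] [CommRing R] [IsLocalRing R]
    [Algebra S R] [AddCommGroup X] [Module R X] {n : ℕ} {π : S}
    (hπ : (Ideal.span {π}).IsMaximal) (e : (R ⊗[S] (Fin n → S)) ≃ₗ[R] X)
    {f : Module.End S (Fin n → S)} {Φ : Module.End R X}
    (hf : ∀ a x, e (a ⊗ₜ[S] f x) = Φ (e (a ⊗ₜ[S] x))) (u : Rˣ)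
    (hu : (u : R) - 1 ∈ IsLocalRing.maximalIdeal R)
    (hun : ¬ algebraMap S R π ∣ ((u : R) - 1) ^ n) :
    ∃ (c : R) (q : Polynomial R), ¬ algebraMap S R π ∣ c ∧
      ((u : R) • Φ - 1) * Polynomial.aeval Φ q = c • 1 ∧
      Polynomial.aeval Φ q * ((u : R) • Φ - 1) = c • 1 := by
  have : Nontrivial S := not_subsingleton_iff_nontrivial.1 fun _ =>
    hπ.ne_top (Subsingleton.elim _ _)
  have : Module.Free R X := Module.Free.of_equiv e
  have : Module.Finite R X := Module.Finite.equiv e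
  let Q : Polynomial S := (f - 1).charpoly
  have hdeg : Q.natDegree = n := by rw [LinearMap.charpoly_natDegree]; simp
  -- Chosen so that `u Φ - 1 = u (Φ - 1 - μ)`; `μ` differs from `u - 1` by a unit factor.
  let μ : R := (u⁻¹ : Rˣ) - 1
  have hμ : μ = -(u⁻¹ : Rˣ) * ((u : R) - 1) := by
    simp only [μ]
    linear_combination u.inv_mul
  have hconj : Φ - 1 = e.conj ((f - 1).baseChange R) := by
    refine LinearMap.ext fun x => ?_
    obtain ⟨t, rfl⟩ := e.surjective x
    rw [LinearEquiv.conj_apply_apply, LinearEquiv.symm_apply_apply]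
    induction t with
    | zero => simp
    | add s t hs ht => rw [map_add, map_add, map_add, map_add, hs, ht]
    | tmul a y => simp [hf]
  have hzero : Polynomial.aeval (Φ - 1) (Q.map (algebraMap S R)) = 0 := by
    have : (Φ - 1).charpoly = Q.map (algebraMap S R) := by
      rw [hconj, LinearEquiv.charpoly_conj, LinearMap.charpoly_baseChange]
    rw [← this, LinearMap.aeval_self_charpoly]
  -- The remainder theorem, evaluated at `Φ - 1` where `Q` vanishes, exhibits `Φ - 1 - μ` as a
  -- divisor of `-Q(μ)`.
  obtain ⟨q, hq⟩ := Polynomial.X_sub_C_dvd_sub_C_eval (a := μ) (p := Q.map (algebraMap S R))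
  have hc : ¬ algebraMap S R π ∣ (Q.map (algebraMap S R)).eval μ := fun h => hun (by
    have h1 := dvd_pow_of_dvd_aeval hπ (LinearMap.charpoly_monic (f - 1))
      (μ := μ) (by rw [hμ]; exact Ideal.mul_mem_left _ _ hu)
      (by rwa [Polynomial.aeval_def, ← Polynomial.eval_map])
    have h2 : (u : R) - 1 = -u * μ := by
      simp only [μ]
      linear_combination u.mul_inv
    rw [h2, mul_pow]
    exact Dvd.dvd.mul_left (hdeg ▸ h1) _)
  have key := congrArg (Polynomial.aeval (Φ - 1)) hq
  rw [map_sub, hzero, map_mul, map_sub, Polynomial.aeval_X, Polynomial.aeval_C,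
    Polynomial.aeval_C, zero_sub] at key
  have hT : Polynomial.aeval Φ (q.comp (Polynomial.X - 1)) = Polynomial.aeval (Φ - 1) q := by
    rw [Polynomial.aeval_comp]
    simp
  have hB : (u : R) • Φ - 1 = (u : R) • (Φ - 1 - algebraMap R (Module.End R X) μ) := by
    simp only [μ, Algebra.algebraMap_eq_smul_one, smul_sub, smul_smul, sub_smul]
    simp
  have h1 : ((u : R) • Φ - 1) * Polynomial.aeval Φ (q.comp (Polynomial.X - 1)) =
      (-(u * (Q.map (algebraMap S R)).eval μ)) • 1 := by
    rw [hT, hB, smul_mul_assoc, ← key, Algebra.algebraMap_eq_smul_one, ← neg_smul, smul_smul,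
      mul_neg]
  refine ⟨-(u * (Q.map (algebraMap S R)).eval μ), q.comp (Polynomial.X - 1), ?_, h1, ?_⟩
  · rwa [dvd_neg, Units.dvd_mul_left]
  · rw [← h1]
    have h2 : (u : R) • Φ - 1 = Polynomial.aeval Φ
        ((u : R) • Polynomial.X - 1 : Polynomial R) := by simp
    rw [h2, ← map_mul, ← map_mul, mul_comm]

/-! ### The rings of integers -/

section Integers

variable {p : ℕ} [Fact p.Prime] {L : Type*} [Field L] [Algebra ℚ_[p] L]
  [Algebra.IsAlgebraic ℚ_[p] L]

theorem specNorm_mul (x y : L) :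
    spectralNorm ℚ_[p] L (x * y) = spectralNorm ℚ_[p] L x * spectralNorm ℚ_[p] L y := by
  have := map_mul (spectralMulAlgNorm ℚ_[p] L) x y
  simpa only [spectralMulAlgNorm_def] using this

theorem specNorm_pow (x : L) (n : ℕ) :
    spectralNorm ℚ_[p] L (x ^ n) = spectralNorm ℚ_[p] L x ^ n := by
  have := map_pow (spectralMulAlgNorm ℚ_[p] L) x n
  simpa only [spectralMulAlgNorm_def] using this

theorem specNorm_pos {x : L} (hx : x ≠ 0) : 0 < spectralNorm ℚ_[p] L x :=
  spectralNorm_zero_lt hx (Algebra.IsAlgebraic.isAlgebraic x)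

theorem isUnit_integers_iff (x : integers p L) :
    IsUnit x ↔ spectralNorm ℚ_[p] L (x : L) = 1 := by
  constructor
  · rintro ⟨u, rfl⟩
    have h1 : spectralNorm ℚ_[p] L ((u : integers p L) : L) ≤ 1 := (u : integers p L).2
    have h2 : spectralNorm ℚ_[p] L (((u⁻¹ : (integers p L)ˣ) : integers p L) : L) ≤ 1 :=
      ((u⁻¹ : (integers p L)ˣ) : integers p L).2
    have h3 := specNorm_mul (p := p) ((u : integers p L) : L)
      (((u⁻¹ : (integers p L)ˣ) : integers p L) : L)
    have h4 : ((u : integers p L) : L) * (((u⁻¹ : (integers p L)ˣ) : integers p L) : L) = 1 :=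
      congrArg Subtype.val u.mul_inv
    rw [h4, spectralNorm_one] at h3
    have h5 := mul_le_of_le_one_right (spectralNorm_nonneg (K := ℚ_[p]) ((u : integers p L) : L)) h2
    linarith
  · intro h
    have hx : (x : L) ≠ 0 := fun h0 => by
      rw [h0, spectralNorm_zero] at h
      exact zero_ne_one h
    have hinv : spectralNorm ℚ_[p] L (x : L)⁻¹ ≤ 1 := by
      have := specNorm_mul (p := p) (x : L) (x : L)⁻¹
      rw [mul_inv_cancel₀ hx, spectralNorm_one, h, one_mul] at this
      exact this.ge
    exact IsUnit.of_mul_eq_one ⟨_, hinv⟩ (Subtype.ext (mul_inv_cancel₀ hx))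

theorem mem_maximalIdeal_integers_iff (x : integers p L) :
    x ∈ IsLocalRing.maximalIdeal (integers p L) ↔ spectralNorm ℚ_[p] L (x : L) < 1 := by
  rw [IsLocalRing.mem_maximalIdeal, mem_nonunits_iff, isUnit_integers_iff]
  exact ⟨fun h => lt_of_le_of_ne x.2 h, fun h => h.ne⟩

theorem residue_integers_eq_iff (x y : integers p L) :
    IsLocalRing.residue (integers p L) x = IsLocalRing.residue (integers p L) y ↔
      spectralNorm ℚ_[p] L ((x : L) - y) < 1 := by
  rw [← sub_eq_zero, ← map_sub, IsLocalRing.residue_eq_zero_iff, mem_maximalIdeal_integers_iff]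
  rfl

theorem specNorm_le_of_dvd {a b : integers p L} (h : a ∣ b) :
    spectralNorm ℚ_[p] L (b : L) ≤ spectralNorm ℚ_[p] L (a : L) := by
  obtain ⟨t, rfl⟩ := h
  exact (specNorm_mul (a : L) (t : L)).trans_le
    (mul_le_of_le_one_right (spectralNorm_nonneg (K := ℚ_[p]) _) t.2)

/-- In the ring of integers, an element that does not divide `c` is a multiple of `c` by an
element of the maximal ideal. -/
theorem exists_eq_mul_of_not_dvd {a c : integers p L} (h : ¬ a ∣ c) :
    ∃ m ∈ IsLocalRing.maximalIdeal (integers p L), a = c * m := by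
  obtain ⟨m, rfl⟩ := (ValuationRing.dvd_total c a).resolve_right h
  refine ⟨m, ?_, rfl⟩
  rw [IsLocalRing.mem_maximalIdeal, mem_nonunits_iff]
  exact fun hm => h (hm.mul_right_dvd.2 dvd_rfl)

/-- Divisibility is total in a valuation ring: a nonunit not divisible by `ϖ` would be a proper
divisor of it. -/
theorem span_irreducible_isMaximal {ϖ : integers p L} (h : Irreducible ϖ) :
    (Ideal.span {ϖ}).IsMaximal := by
  have : Ideal.span {ϖ} = IsLocalRing.maximalIdeal (integers p L) := by
    refine le_antisymm (IsLocalRing.le_maximalIdeal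
      (by rw [Ne, Ideal.span_singleton_eq_top]; exact h.not_isUnit)) fun x hx => ?_
    rw [Ideal.mem_span_singleton]
    by_contra hx'
    obtain ⟨m, hm, e⟩ := exists_eq_mul_of_not_dvd hx'
    exact (h.isUnit_or_isUnit e).elim hx hm
  rw [this]
  exact IsLocalRing.maximalIdeal.isMaximal _

end Integers

/-! ### Inertia and Frobenius generate the Galois group topologically -/

section Density

variable {p : ℕ} [Fact p.Prime]

theorem isLocalHom_integers {L M : Type*} [Field L] [Algebra ℚ_[p] L]
    [Algebra.IsAlgebraic ℚ_[p] L] [Field M] [Algebra ℚ_[p] M] [Algebra.IsAlgebraic ℚ_[p] M]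
    (f : integers p L →+* integers p M)
    (hf : ∀ x, spectralNorm ℚ_[p] M (f x : M) = spectralNorm ℚ_[p] L (x : L)) : IsLocalHom f :=
  ⟨fun x hx => by rwa [isUnit_integers_iff, hf, ← isUnit_integers_iff] at hx⟩

/-- An integral element of an algebraic extension of `ℚ_p` is a root of a monic polynomial
over `ℤ_p`. -/
theorem isIntegral_padicInt {L : Type*} [Field L] [Algebra ℚ_[p] L]
    [Algebra.IsAlgebraic ℚ_[p] L] {x : L} (hx : spectralNorm ℚ_[p] L x ≤ 1) :
    ((algebraMap ℚ_[p] L).comp (algebraMap ℤ_[p] ℚ_[p])).IsIntegralElem x := by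
  have hm := minpoly.monic (Algebra.IsIntegral.isIntegral (R := ℚ_[p]) x)
  have hcoeff := (spectralValue_le_one_iff hm).1 hx
  have hlift : minpoly ℚ_[p] x ∈ Polynomial.lifts (algebraMap ℤ_[p] ℚ_[p]) := by
    rw [Polynomial.lifts_iff_coeff_lifts]
    exact fun n => ⟨⟨_, hcoeff n⟩, rfl⟩
  obtain ⟨P, hP, -, hPm⟩ := Polynomial.lifts_and_natDegree_eq_and_monic hlift hm
  refine ⟨P, hPm, ?_⟩
  rw [← Polynomial.eval₂_map, hP]
  exact minpoly.aeval ℚ_[p] x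

variable {K : Type*} [Field K] [Algebra ℚ_[p] K]

/-- The set is a union of cosets of the stabiliser of `x`, which is open because `x` is algebraic
over `K`. -/
theorem isOpen_setOf_absGal_apply_mem (x : AlgebraicClosure K) (s : Set (AlgebraicClosure K)) :
    IsOpen {g : absGal K | g x ∈ s} := by
  rw [isOpen_iff_mem_nhds]
  intro g hg
  have hs := stabilizer_isOpen_of_isIntegral (K := K) x
  have h1 : (fun h : absGal K => g⁻¹ * h) ⁻¹'
      (MulAction.stabilizer (absGal K) x : Set (absGal K)) ∈ nhds g := by
    refine (hs.preimage (continuous_const_mul g⁻¹)).mem_nhds ?_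
    simp
  filter_upwards [h1] with h hh
  have h2 : g⁻¹ (h x) = x := hh
  have h3 : h x = g x := (g.apply_symm_apply (h x)).symm.trans (congrArg g h2)
  change h x ∈ s
  rw [h3]
  exact hg

variable [Algebra.IsAlgebraic ℚ_[p] K]

theorem inertia_normal : (inertia p K).Normal := by
  refine ⟨fun n hn g x hx => ?_⟩
  have h1 := hn (g⁻¹ x) (by rwa [spectralNorm_absGal])
  rw [← spectralNorm_absGal p K g, map_sub] at h1
  have h2 : g (g⁻¹ x) = x := g.apply_symm_apply x
  rwa [h2] at h1

variable (p K) in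
/-- The inclusion of the integers of `K` in those of its algebraic closure. -/
def integersToClosure [Algebra.IsAlgebraic ℚ_[p] (AlgebraicClosure K)] :
    integers p K →+* integers p (AlgebraicClosure K) :=
  ((algebraMap K (AlgebraicClosure K)).comp (integers p K).subtype).codRestrict
    (integers p (AlgebraicClosure K)) fun x => by
      have h : spectralNorm ℚ_[p] K x.1 ≤ 1 := x.2
      rw [spectralNorm.eq_of_tower (K := ℚ_[p]) (E := K) (L := AlgebraicClosure K)] at h
      exact h

/-- The action of the Galois group on the integers of the algebraic closure. -/
def galIntegers [Algebra.IsAlgebraic ℚ_[p] (AlgebraicClosure K)] (g : absGal K) :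
    integers p (AlgebraicClosure K) →+* integers p (AlgebraicClosure K) :=
  ((g : AlgebraicClosure K →+* AlgebraicClosure K).comp
    (integers p (AlgebraicClosure K)).subtype).codRestrict
    (integers p (AlgebraicClosure K)) fun x =>
      (spectralNorm_absGal p K g x.1).trans_le x.2

instance [Algebra.IsAlgebraic ℚ_[p] (AlgebraicClosure K)] : IsLocalHom (integersToClosure p K) :=
  isLocalHom_integers _ fun x => (spectralNorm.eq_of_tower (K := ℚ_[p]) (x : K)).symm

instance [Algebra.IsAlgebraic ℚ_[p] (AlgebraicClosure K)] (g : absGal K) :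
    IsLocalHom (galIntegers (p := p) g) :=
  isLocalHom_integers _ fun x => spectralNorm_absGal p K g x

/-- On finitely many elements of the residue field of the algebraic closure, an element of the
Galois group acts as a power of the Frobenius. -/
theorem exists_forall_residue_eq_pow [Algebra.IsAlgebraic ℚ_[p] (AlgebraicClosure K)]
    [Finite (resField p K)] (g : absGal K) (s : Finset (integers p (AlgebraicClosure K))) :
    ∃ m : ℕ, ∀ x ∈ s, IsLocalRing.residue _ (galIntegers g x) =
      IsLocalRing.residue (integers p (AlgebraicClosure K)) x ^ Nat.card (resField p K) ^ m := by
  classical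
  let k := resField p K
  let κ := resField p (AlgebraicClosure K)
  let i : k →+* κ := IsLocalRing.ResidueField.map (integersToClosure p K)
  let _ : Algebra k κ := i.toAlgebra
  have hi : ∀ y : integers p K, algebraMap k κ (IsLocalRing.residue _ y) =
      IsLocalRing.residue _ (integersToClosure p K y) := fun y => rfl
  let γ : κ →ₐ[k] κ :=
    { IsLocalRing.ResidueField.map (galIntegers (p := p) g) with
      commutes' := fun y => by
        obtain ⟨y, rfl⟩ := IsLocalRing.residue_surjective y
        rw [hi]
        change IsLocalRing.residue _ (galIntegers g (integersToClosure p K y)) = _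
        congr 1
        exact Subtype.ext (g.commutes (y : K)) }
  have hγ : ∀ x, γ (IsLocalRing.residue _ x) = IsLocalRing.residue _ (galIntegers g x) :=
    fun x => rfl
  -- Residues are algebraic over `k`: reduce a monic equation over `ℤ_p` satisfied by a lift.
  have hint : ∀ x : κ, IsIntegral k x := fun x => by
    obtain ⟨x, rfl⟩ := IsLocalRing.residue_surjective x
    obtain ⟨P, hP, hP0⟩ := isIntegral_padicInt x.2
    let j : ℤ_[p] →+* integers p K :=
      ((algebraMap ℚ_[p] K).comp (algebraMap ℤ_[p] ℚ_[p])).codRestrict (integers p K) fun z =>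
        (spectralNorm_extends (K := ℚ_[p]) (L := K) (z : ℚ_[p])).trans_le z.2
    refine ⟨P.map ((IsLocalRing.residue _).comp j), hP.map _, ?_⟩
    have h1 : P.eval₂ ((integersToClosure p K).comp j) x = 0 := by
      apply Subtype.ext
      have h2 := Polynomial.hom_eval₂ P ((integersToClosure p K).comp j)
        (integers p (AlgebraicClosure K)).subtype x
      refine h2.trans ?_
      refine Eq.trans ?_ hP0
      congr 1
    rw [Polynomial.eval₂_map]
    have h3 := Polynomial.hom_eval₂ P ((integersToClosure p K).comp j)
      (IsLocalRing.residue (integers p (AlgebraicClosure K))) x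
    rw [h1, map_zero] at h3
    exact h3.symm
  -- Finitely many residues generate a finite extension of the finite field `k`, and each of its
  -- automorphisms is a power of `y ↦ y ^ |k|`.
  let ℓ : IntermediateField k κ := IntermediateField.adjoin k
    (s.image (IsLocalRing.residue (integers p (AlgebraicClosure K))) : Set κ)
  have : FiniteDimensional k ℓ :=
    IntermediateField.finiteDimensional_adjoin fun x _ => hint x
  have : Finite ℓ := Module.finite_of_finite k
  have : IsGalois k ℓ := inferInstance
  obtain ⟨r, hr⟩ := CharP.exists k
  have : Fact r.Prime := ⟨CharP.char_is_prime k r⟩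
  obtain ⟨m, hm⟩ := FiniteField.exists_forall_apply_eq_pow k r ℓ
    (AlgEquiv.ofBijective (γ.restrictNormal ℓ)
      (Finite.injective_iff_bijective.1 (γ.restrictNormal ℓ).toRingHom.injective))
  refine ⟨m, fun x hx => ?_⟩
  have hx' : IsLocalRing.residue _ x ∈ ℓ := IntermediateField.subset_adjoin _ _
    (by exact_mod_cast Finset.mem_image_of_mem _ hx)
  have h1 := congrArg (algebraMap ℓ κ) (hm ⟨_, hx'⟩)
  rw [AlgEquiv.ofBijective_apply, AlgHom.restrictNormal_commutes, map_pow] at h1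
  exact (hγ x).symm.trans h1

/-- `Nat.card` of an infinite type is `0`, in which case the Frobenius congruence at `x = 0` would
read `|0 - 0 ^ 0| < 1`. -/
theorem finite_resField {Φ : absGal K} (hΦ : IsGeomFrob p K Φ) : Finite (resField p K) := by
  refine Nat.finite_of_card_ne_zero fun h => ?_
  have := isAlgebraic_algebraicClosure p K
  have h0 := hΦ 0 (by rw [spectralNorm_zero]; exact zero_le_one)
  rw [h, pow_zero, map_zero, zero_sub, spectralNorm_neg (Algebra.IsAlgebraic.isAlgebraic _),
    spectralNorm_one] at h0
  exact lt_irrefl _ h0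

/-- An open subgroup containing inertia and a Frobenius element is the whole Galois group. -/
theorem eq_top_of_isOpen {Φ : absGal K} (hΦ : IsGeomFrob p K Φ) {H : Subgroup (absGal K)}
    (hH : IsOpen (H : Set (absGal K))) (hI : inertia p K ≤ H) (hΦH : Φ ∈ H) : H = ⊤ := by
  have := isAlgebraic_algebraicClosure p K
  have : Finite (resField p K) := finite_resField hΦ
  have : CharZero K := charZero_of_injective_algebraMap (algebraMap ℚ_[p] K).injective
  let C : integers p (AlgebraicClosure K) → Set (absGal K) := fun x =>
    {g | spectralNorm ℚ_[p] (AlgebraicClosure K) (g x - x) < 1}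
  have hC : ∀ x, IsClosed (C x) := fun x =>
    ⟨isOpen_setOf_absGal_apply_mem (x : AlgebraicClosure K)
      {y | ¬ spectralNorm ℚ_[p] (AlgebraicClosure K) (y - x) < 1}⟩
  -- Inertia is the intersection of the closed sets `C x`. By compactness of the complement of `H`,
  -- finitely many of these conditions already force membership in `H`.
  obtain ⟨s, hs⟩ := hH.isClosed_compl.isCompact.elim_finite_subfamily_closed C hC (by
    rw [Set.eq_empty_iff_forall_notMem]
    rintro g ⟨hg, hg'⟩
    exact hg (hI fun x hx => Set.mem_iInter.1 hg' ⟨x, hx⟩))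
  have hpow : ∀ (m : ℕ) (x : integers p (AlgebraicClosure K)),
      IsLocalRing.residue _ (galIntegers (Φ⁻¹ ^ m) x) =
        IsLocalRing.residue _ x ^ Nat.card (resField p K) ^ m := by
    intro m
    induction m with
    | zero =>
      intro x
      rw [pow_zero, pow_zero, pow_one]
      rfl
    | succ m ih =>
      intro x
      have h1 : galIntegers (Φ⁻¹ ^ (m + 1)) x = galIntegers (Φ⁻¹ ^ m) (galIntegers Φ⁻¹ x) := by
        rw [pow_succ]
        rfl
      have h2 : IsLocalRing.residue (integers p (AlgebraicClosure K)) (galIntegers Φ⁻¹ x) =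
          IsLocalRing.residue _ (x ^ Nat.card (resField p K)) :=
        (residue_integers_eq_iff _ _).2 (hΦ x x.2)
      rw [h1, ih, h2, map_pow, ← pow_mul, pow_succ']
  rw [eq_top_iff]
  intro g _
  obtain ⟨m, hm⟩ := exists_forall_residue_eq_pow (p := p) g s
  -- On the residues of `s`, `g` acts as `Φ⁻¹ ^ m`, so `Φ ^ m * g` satisfies those finitely many
  -- conditions.
  have hmem : Φ ^ m * g ∈ H := by
    by_contra hcon
    refine Set.eq_empty_iff_forall_notMem.1 hs _ ⟨hcon, Set.mem_iInter₂.2 fun x hx => ?_⟩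
    have h1 := (residue_integers_eq_iff _ _).1 ((hm x hx).trans (hpow m x).symm)
    have h2 : spectralNorm ℚ_[p] (AlgebraicClosure K) (g x - (Φ⁻¹ ^ m) x) < 1 := h1
    rw [← spectralNorm_absGal p K (Φ ^ m), map_sub] at h2
    have h3 : (Φ ^ m) ((Φ⁻¹ ^ m) (x : AlgebraicClosure K)) = x := by
      rw [inv_pow]
      exact (Φ ^ m).apply_symm_apply _
    rwa [h3] at h2
  exact (Subgroup.mul_mem_cancel_left H (pow_mem hΦH m)).1 hmem

end Density

/-! ### Unramified classes -/

section Unramified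

variable {p : ℕ} [Fact p.Prime] {K : Type*} [Field K] [Algebra ℚ_[p] K]
  [Algebra.IsAlgebraic ℚ_[p] K] {R M : Type*} [CommRing R] [AddCommGroup M] [Module R M]

theorem mk_mem_H1ur_iff {ρ : Representation R (absGal K) M} (z : Z1 ρ) :
    (Submodule.Quotient.mk z : H1 ρ) ∈ H1ur p ρ ↔
      ∃ m, ∀ g ∈ inertia p K, z.1 g = ρ g m - m := by
  rw [H1ur, LinearMap.mem_ker]
  change (Submodule.Quotient.mk (Z1res ρ (inertia p K) z) : H1 (resRep ρ (inertia p K))) = 0 ↔ _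
  rw [Submodule.Quotient.mk_eq_zero]
  exact ⟨fun ⟨m, hm⟩ => ⟨m, fun g hg => hm ⟨g, hg⟩⟩, fun ⟨m, hm⟩ => ⟨m, fun g => hm g g.2⟩⟩

/-- A continuous cocycle is determined by its values on inertia and at a Frobenius element. -/
theorem Z1_ext {ρ : Representation R (absGal K) M} {Φ : absGal K} (hΦ : IsGeomFrob p K Φ)
    {z w : Z1 ρ} (hI : ∀ g ∈ inertia p K, z.1 g = w.1 g) (hzw : z.1 Φ = w.1 Φ) : z = w := by
  have hadd : ∀ g h, (z - w).1 (g * h) = (z - w).1 g + ρ g ((z - w).1 h) := (z - w).2.2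
  have hone : (z - w).1 1 = 0 := by simpa using hadd 1 1
  -- The zero set of a cocycle is a subgroup, and it is open because the cocycle is locally
  -- constant.
  let H : Subgroup (absGal K) :=
    { carrier := {g | (z - w).1 g = 0}
      one_mem' := hone
      mul_mem' := fun {g h} hg hh => by
        change (z - w).1 (g * h) = 0
        rw [hadd, hg, hh, map_zero, add_zero]
      inv_mem' := fun {g} hg => by
        have := hadd g⁻¹ g
        rw [inv_mul_cancel, hone, hg, map_zero, add_zero] at this
        exact this.symm }
  have hopen : IsOpen (H : Set (absGal K)) := (z - w).2.1 {0}
  have htop := eq_top_of_isOpen hΦ hopen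
    (fun g hg => sub_eq_zero.2 (hI g hg)) (sub_eq_zero.2 hzw)
  refine Subtype.ext (funext fun g => sub_eq_zero.1 ?_)
  exact (htop ▸ Subgroup.mem_top g : g ∈ H)

variable {R' M' : Type*} [CommRing R'] [AddCommGroup M'] [Module R' M']

theorem H1map_mem_H1ur {ρ : Representation R (absGal K) M} {ρ' : Representation R' (absGal K) M'}
    (f : M →+ M') (hf : ∀ g m, f (ρ g m) = ρ' g (f m)) {x : H1 ρ} (hx : x ∈ H1ur p ρ) :
    H1map ρ ρ' f hf x ∈ H1ur p ρ' := by
  obtain ⟨z, rfl⟩ := Submodule.Quotient.mk_surjective _ x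
  obtain ⟨m, hm⟩ := (mk_mem_H1ur_iff z).1 hx
  refine (mk_mem_H1ur_iff (Z1map ρ ρ' f hf z)).2 ⟨f m, fun g hg => ?_⟩
  rw [← hf, ← map_sub, ← hm g hg]
  rfl

/-- Equivariant maps commute with restriction to inertia; apply this to `φ` and to its inverse. Only
additivity matters, so the two coefficient rings may differ. -/
theorem H1ur_map_eq {ρ : Representation R (absGal K) M} {ρ' : Representation R' (absGal K) M'}
    (φ : M ≃+ M') (hφ : ∀ g m, φ.toAddMonoidHom (ρ g m) = ρ' g (φ.toAddMonoidHom m)) :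
    (H1ur p ρ).toAddSubgroup.map (H1map ρ ρ' φ.toAddMonoidHom hφ) =
      (H1ur p ρ').toAddSubgroup := by
  have hφ' : ∀ g m, φ.symm.toAddMonoidHom (ρ' g m) = ρ g (φ.symm.toAddMonoidHom m) := by
    intro g m
    apply φ.injective
    have := hφ g (φ.symm m)
    simp only [AddEquiv.toAddMonoidHom_eq_coe, AddMonoidHom.coe_coe,
      AddEquiv.apply_symm_apply] at this ⊢
    exact this.symm
  refine le_antisymm ?_ fun x hx => ⟨H1map ρ' ρ φ.symm.toAddMonoidHom hφ' x,
    H1map_mem_H1ur _ hφ' hx, ?_⟩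
  · rintro _ ⟨x, hx, rfl⟩
    exact H1map_mem_H1ur _ hφ hx
  · obtain ⟨z, rfl⟩ := Submodule.Quotient.mk_surjective _ x
    change (Submodule.Quotient.mk (Z1map ρ ρ' φ.toAddMonoidHom hφ
      (Z1map ρ' ρ φ.symm.toAddMonoidHom hφ' z)) : H1 ρ') = _
    congr 1
    exact Subtype.ext (funext fun g => φ.apply_symm_apply (z.1 g))

end Unramified

/-! ### Stabilisers and divided cochains -/

section Generic

variable {R G : Type*} [CommRing R] [Group G] {A B C D : Type*} [AddCommGroup A] [Module R A]
  [AddCommGroup B] [Module R B] [AddCommGroup C] [Module R C] [AddCommGroup D] [Module R D]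

/-- The stabiliser of a vector in a representation. -/
def stab (ρ : Representation R G A) (a : A) : Subgroup G where
  carrier := {g | ρ g a = a}
  one_mem' := by
    change ρ 1 a = a
    rw [map_one, Module.End.one_apply]
  mul_mem' := fun {g h} hg hh => by
    change ρ (g * h) a = a
    rw [map_mul, Module.End.mul_apply, hh, hg]
  inv_mem' := fun {g} hg => by
    change ρ g⁻¹ a = a
    conv_lhs => rw [← hg]
    rw [← Module.End.mul_apply, ← map_mul, inv_mul_cancel, map_one, Module.End.one_apply]

theorem mem_stab {ρ : Representation R G A} {a : A} {g : G} : g ∈ stab ρ a ↔ ρ g a = a := Iff.rfl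

/-- Once `c b` is known to be integral, the cochain of `b` becomes, after multiplication by `c`, an
honest coboundary inside `A`. -/
theorem ConnectingData.smul_cochain_eq [TopologicalSpace G] {ρA : Representation R G A}
    {ρB : Representation R G B} {ρC : Representation R G C} {ρD : Representation R G D}
    {i : A →ₗ[R] B} {q : B →ₗ[R] C} {r : A →ₗ[R] D} (h : ConnectingData ρA ρB ρC ρD i q r)
    {c : R} {a a' : A} {b : B} {g : G} (ha : i a = ρB g b - b) (ha' : i a' = c • b) :
    c • a = ρA g a' - a' := by
  apply h.inj
  rw [map_smul, ha, map_sub, h.i_equiv, ha', map_smul, smul_sub]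

theorem ConnectingData.mem_stab [TopologicalSpace G] {ρA : Representation R G A}
    {ρB : Representation R G B} {ρC : Representation R G C} {ρD : Representation R G D}
    {i : A →ₗ[R] B} {q : B →ₗ[R] C} {r : A →ₗ[R] D} (h : ConnectingData ρA ρB ρC ρD i q r)
    {a : A} {b : B} {g : G} (ha : i a = ρB g b - b) : g ∈ stab ρC (q b) := by
  rw [GalTwist.mem_stab, ← h.q_equiv, ← sub_eq_zero, ← map_sub, ← ha]
  exact (h.exact _).2 ⟨a, rfl⟩

theorem tensorTriv_tmul {N : Type*} [AddCommGroup N] [Module R N] (ρ : Representation R G A)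
    (g : G) (a : A) (x : N) : tensorTriv ρ N g (a ⊗ₜ x) = ρ g a ⊗ₜ x := by
  rw [Representation.tprod_apply, TensorProduct.map_tmul]
  rfl

/-- Extension of scalars of the relation `T (g - 1) = c`. -/
theorem rTensor_sub_eq_smul {N : Type*} [AddCommGroup N] [Module R N]
    {ρ : Representation R G A} {T : Module.End R A} {g : G} {c : R}
    (hT : ∀ a, T (ρ g a - a) = c • a) (d : A ⊗[R] N) :
    T.rTensor N (tensorTriv ρ N g d - d) = c • d := by
  induction d with
  | zero => simp
  | add d d' hd hd' =>
    rw [smul_add, ← hd, ← hd', ← map_add, map_add]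
    congr 1
    abel
  | tmul d f =>
    rw [tensorTriv_tmul, ← TensorProduct.sub_tmul, LinearMap.rTensor_tmul, hT,
      TensorProduct.smul_tmul']

end Generic

/-! ### Reduction of lattices -/

section Reduction

variable {p : ℕ} [Fact p.Prime] {F : Type*} [Field F] [Algebra ℚ_[p] F]
  [FiniteDimensional ℚ_[p] F] {G X : Type*} [Group G] [AddCommGroup X]
  [Module (integers p F) X]

theorem tmul_one_eq_zero_iff (x : X) : x ⊗ₜ[integers p F] (1 : resField p F) = 0 ↔
    x ∈ IsLocalRing.maximalIdeal (integers p F) • (⊤ : Submodule (integers p F) X) := by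
  rw [← LinearMap.ker_tensorProductMk, LinearMap.mem_ker,
    ← (TensorProduct.comm (integers p F) X (resField p F)).map_eq_zero_iff]
  rfl

theorem exists_tmul_one_eq (m : X ⊗[integers p F] resField p F) : ∃ x : X, x ⊗ₜ 1 = m := by
  induction m with
  | zero => exact ⟨0, TensorProduct.zero_tmul _ _⟩
  | add m n hm hn =>
    obtain ⟨x, rfl⟩ := hm
    obtain ⟨y, rfl⟩ := hn
    exact ⟨x + y, TensorProduct.add_tmul _ _ _⟩
  | tmul x r =>
    obtain ⟨s, rfl⟩ := IsLocalRing.residue_surjective r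
    refine ⟨s • x, ?_⟩
    rw [TensorProduct.smul_tmul, Algebra.smul_def, mul_one]
    rfl

theorem smul_tmul_one_eq_zero {s : integers p F}
    (hs : s ∈ IsLocalRing.maximalIdeal (integers p F)) (x : X) :
    (s • x) ⊗ₜ[integers p F] (1 : resField p F) = 0 :=
  (tmul_one_eq_zero_iff _).2 (Submodule.smul_mem_smul hs trivial)

theorem natCast_mem_maximalIdeal : (p : integers p F) ∈ IsLocalRing.maximalIdeal (integers p F) :=
  (IsLocalRing.residue_eq_zero_iff _).1 natCast_prime_resField

theorem tensorTriv_tmul_one (ρ : Representation (integers p F) G X) (g : G) (x : X) :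
    tensorTriv ρ (resField p F) g (x ⊗ₜ 1) = ρ g x ⊗ₜ 1 :=
  tensorTriv_tmul ρ g x 1

theorem reduction_eq (a : X ⊗[integers p F] (integers p F)) :
    reduction p X a = TensorProduct.rid (integers p F) X a ⊗ₜ 1 := by
  induction a with
  | zero => simp
  | add a b ha hb => rw [map_add, map_add, TensorProduct.add_tmul, ha, hb]
  | tmul x s =>
    rw [TensorProduct.rid_tmul, TensorProduct.smul_tmul, Algebra.smul_def, mul_one]
    rfl

theorem rid_twist (ρ : Representation (integers p F) G X) (ψ : G →* (integers p F)ˣ) (g : G)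
    (a : X ⊗[integers p F] (integers p F)) :
    TensorProduct.rid (integers p F) X (twist ρ ψ g a) =
      (ψ g : integers p F) • ρ g (TensorProduct.rid (integers p F) X a) := by
  induction a with
  | zero => simp
  | add a b ha hb => simp only [map_add, smul_add, ha, hb]
  | tmul x s => simp [charRep, smul_smul, mul_comm]

theorem isLocallyConstant_tensorTriv [TopologicalSpace G]
    {ρ : Representation (integers p F) G X}
    (hρ : IsContRep p ρ) (m : X ⊗[integers p F] resField p F) :
    IsLocallyConstant fun g => tensorTriv ρ (resField p F) g m := by
  obtain ⟨x, rfl⟩ := exists_tmul_one_eq m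
  refine (IsLocallyConstant.iff_eventually_eq _).2 fun g₀ => ?_
  filter_upwards [hρ.eventually x 1 g₀] with g ⟨y, hy⟩
  rw [tensorTriv_tmul_one, tensorTriv_tmul_one, ← sub_eq_zero, ← TensorProduct.sub_tmul, hy,
    pow_one, smul_tmul_one_eq_zero natCast_mem_maximalIdeal]

/-- The coboundary `g ↦ g m - m`. -/
def coboundary [TopologicalSpace G] {ρ : Representation (integers p F) G X} (hρ : IsContRep p ρ)
    (m : X ⊗[integers p F] resField p F) : Z1 (tensorTriv ρ (resField p F)) :=
  ⟨fun g => tensorTriv ρ (resField p F) g m - m,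
    (isLocallyConstant_tensorTriv hρ m).sub (IsLocallyConstant.const m), fun g h => by
      beta_reduce
      rw [map_mul, map_sub, Module.End.mul_apply]
      abel⟩

/-- Computes the cochain of the fraction `a / c`; this is how elements with a prescribed connecting
class are built. -/
theorem tensorTriv_twist_sub_eq {ρ : Representation (integers p F) G X}
    {ψ : G →* (integers p F)ˣ} {g : G} {c : integers p F} (hc : c ≠ 0)
    {a w : X ⊗[integers p F] (integers p F)} (h : twist ρ ψ g a - a = c • w) :
    toF p _ w = tensorTriv (twist ρ ψ) F g (a ⊗ₜ (c : F)⁻¹) - a ⊗ₜ (c : F)⁻¹ := by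
  have hc' : (c : F) ≠ 0 := fun h0 => hc (Subtype.ext h0)
  rw [tensorTriv_tmul, ← TensorProduct.sub_tmul, h, TensorProduct.smul_tmul, Algebra.smul_def]
  have e' : algebraMap (integers p F) F c * (c : F)⁻¹ = 1 := mul_inv_cancel₀ hc'
  rw [e']
  rfl

end Reduction

/-! ### The image of the connecting map -/

section Image

variable {p : ℕ} [Fact p.Prime] {K : Type*} [Field K] [Algebra ℚ_[p] K]
  [Algebra.IsAlgebraic ℚ_[p] K] {F : Type*} [Field F] [Algebra ℚ_[p] F]
  [FiniteDimensional ℚ_[p] F] {X : Type*} [AddCommGroup X] [Module (integers p F) X]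
  {ρ : Representation (integers p F) (absGal K) X} {ψ : absGal K →* (integers p F)ˣ}
  {Φ : absGal K}

/-- The kernel of the residual character is open and contains both inertia and `Φ`. -/
theorem residue_eq_one_of_unramified (hΦ : IsGeomFrob p K Φ) (hψ : IsContRep p (charRep ψ))
    (hunr : ∀ g ∈ inertia p K, ψ g = 1)
    (h : (ψ Φ : integers p F) - 1 ∈ IsLocalRing.maximalIdeal (integers p F)) (g : absGal K) :
    IsLocalRing.residue (integers p F) (ψ g) = 1 := by
  let H : Subgroup (absGal K) :=
    ((Units.map (IsLocalRing.residue (integers p F) : integers p F →* resField p F)).comp ψ).ker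
  have hH : ∀ g, g ∈ H ↔ IsLocalRing.residue (integers p F) (ψ g) = 1 := fun g => by
    rw [MonoidHom.mem_ker, Units.ext_iff]
    rfl
  have hopen : IsOpen (H : Set (absGal K)) := by
    refine Subgroup.isOpen_of_mem_nhds H (g := 1) ?_
    filter_upwards [hψ.eventually 1 1 1] with g ⟨y, hy⟩
    refine (hH g).2 ?_
    have e : (ψ g : integers p F) - 1 = p * y := by simpa [charRep] using hy
    rw [← sub_eq_zero, ← map_one (IsLocalRing.residue (integers p F)), ← map_sub,
      IsLocalRing.residue_eq_zero_iff, e]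
    exact Ideal.mul_mem_right _ _ natCast_mem_maximalIdeal
  have htop := eq_top_of_isOpen hΦ hopen
    (fun g hg => (hH g).2 (by rw [hunr g hg, Units.val_one, map_one]))
    ((hH Φ).2 (by
      rw [← sub_eq_zero, ← map_one (IsLocalRing.residue (integers p F)), ← map_sub,
        IsLocalRing.residue_eq_zero_iff]
      exact h))
  exact (hH g).1 (htop ▸ Subgroup.mem_top g)

/-- Dividing by `log |π| < 0` reverses inequalities: positive valuation means `|u| < 1`, and `n v(u)
< 1 = v(π)` means `|u ^ n| > |π|`. The case `n = 0` is included. -/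
theorem mem_maximalIdeal_and_not_dvd_pow_of_normalizedVal {π u : integers p F} (hπ0 : π ≠ 0)
    (hπ : π ∈ IsLocalRing.maximalIdeal (integers p F)) {n : ℕ}
    (hv₀ : 0 < normalizedVal p (π : F) (u : F)) (hv₁ : n * normalizedVal p (π : F) (u : F) < 1) :
    u ∈ IsLocalRing.maximalIdeal (integers p F) ∧ ¬ π ∣ u ^ n := by
  have hπ1 := (mem_maximalIdeal_integers_iff π).1 hπ
  have hπpos : 0 < spectralNorm ℚ_[p] F (π : F) := specNorm_pos fun h => hπ0 (Subtype.ext h)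
  have hlog := Real.log_neg hπpos hπ1
  -- As `Real.log 0 = 0`, the element `0` gets valuation `0`, so positivity excludes it.
  have hu0 : (u : F) ≠ 0 := fun h => by
    rw [normalizedVal, h, spectralNorm_zero, Real.log_zero, zero_div] at hv₀
    exact lt_irrefl _ hv₀
  have hupos : 0 < spectralNorm ℚ_[p] F (u : F) := specNorm_pos hu0
  have hulog : Real.log (spectralNorm ℚ_[p] F (u : F)) < 0 := by
    by_contra h
    exact hv₀.not_ge (div_nonpos_of_nonneg_of_nonpos (not_lt.1 h) hlog.le)
  refine ⟨(mem_maximalIdeal_integers_iff u).2 ((Real.log_neg_iff hupos).1 hulog), fun h => ?_⟩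
  have h1 : spectralNorm ℚ_[p] F (u : F) ^ n ≤ spectralNorm ℚ_[p] F (π : F) := by
    have e : ((u ^ n : integers p F) : F) = (u : F) ^ n := map_pow (integers p F).subtype u n
    rw [← specNorm_pow, ← e]
    exact specNorm_le_of_dvd h
  have h2 := Real.log_le_log (pow_pos hupos n) h1
  rw [Real.log_pow] at h2
  rw [normalizedVal, ← mul_div_assoc, div_lt_one_of_neg hlog] at hv₁
  exact hv₁.not_ge h2

variable [Module.Free (integers p F) X]

/-- If `ψ Φ ρ(Φ) - 1` divides a scalar `c` with `π = c m`, and invariants of inertia modulo `c` lift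
to invariants modulo `π`, then all classes in the image of the connecting map are unramified. -/
theorem range_deltaDual_le (hρ : IsContRep p ρ) (hψ : IsContRep p (charRep ψ))
    (hres : ∀ g, IsLocalRing.residue (integers p F) (ψ g) = 1)
    (hunr : ∀ g ∈ inertia p K, ψ g = 1) {c m : integers p F} (hc : c ≠ 0)
    (hm : m ∈ IsLocalRing.maximalIdeal (integers p F)) {T : Module.End (integers p F) X}
    (hT : T * ((ψ Φ : integers p F) • ρ Φ - 1) = c • 1)
    (hlift : ∀ a, (∀ g ∈ inertia p K, ∃ z, ρ g a - a = c • z) →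
      ∃ y, ∀ g ∈ inertia p K, ∃ z, ρ g (a - c • y) - (a - c • y) = (c * m) • z) :
    LinearMap.range (deltaDual hρ hψ hres) ≤ H1ur p (tensorTriv ρ (resField p F)) := by
  rintro _ ⟨x, rfl⟩
  let D := connectingData hρ hψ hres
  obtain ⟨b, hb⟩ := D.surj x.1
  have hbx : toFmodO p _ b ∈ (tensorTriv (twist ρ ψ) (FmodO p F)).invariants := by
    rw [hb]
    exact x.2
  have hdelta : deltaDual hρ hψ hres x = Submodule.Quotient.mk (D.cocycle b hbx) :=
    D.delta_eq x b hb
  rw [hdelta, mk_mem_H1ur_iff]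
  choose a ha using D.exists_cochain b hbx
  let r := TensorProduct.rid (integers p F) X
  let T' : Module.End (integers p F) (X ⊗[integers p F] (integers p F)) := r.symm.conj T
  have hT'r : ∀ d, T' (twist ρ ψ Φ d - d) = c • d := fun d => by
    apply r.injective
    have h1 := LinearMap.congr_fun hT (r d)
    simp only [Module.End.mul_apply, LinearMap.sub_apply, LinearMap.smul_apply,
      Module.End.one_apply] at h1
    rw [map_smul, ← h1, LinearEquiv.conj_apply_apply, LinearEquiv.apply_symm_apply,
      LinearEquiv.symm_symm, map_sub, rid_twist]
  -- Applying the cofactor to `Φb - b` recovers `c b`, which is therefore integral.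
  have hcb : toF p _ (T' (a Φ)) = c • b := by
    rw [← rTensor_sub_eq_smul hT'r b, ← ha]
    rfl
  have hca : ∀ g, c • a g = twist ρ ψ g (T' (a Φ)) - T' (a Φ) := fun g =>
    D.smul_cochain_eq (ha g) hcb
  have hcx : ∀ g ∈ inertia p K, ρ g (r (T' (a Φ))) - r (T' (a Φ)) = c • r (a g) := fun g hg => by
    rw [← map_smul, hca, map_sub, rid_twist, hunr g hg, Units.val_one, one_smul]
  obtain ⟨y, hy⟩ := hlift _ fun g hg => ⟨_, hcx g hg⟩
  refine ⟨y ⊗ₜ 1, fun g hg => ?_⟩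
  obtain ⟨z, hz⟩ := hy g hg
  have hag : r (a g) = ρ g y - y + m • z := by
    apply smul_right_injective _ hc
    change c • _ = c • _
    rw [smul_add, smul_smul, ← hz, ← hcx g hg, map_sub, map_smul, smul_sub]
    abel
  rw [D.cocycle_eq b hbx g (a g) (ha g), reduction_eq, tensorTriv_tmul_one,
    ← TensorProduct.sub_tmul]
  change r (a g) ⊗ₜ 1 = _
  rw [hag, TensorProduct.add_tmul, smul_tmul_one_eq_zero hm, add_zero]

set_option maxHeartbeats 800000 in
/-- If a scalar `c` with `π = c m` is divisible by `ψ Φ ρ(Φ) - 1`, and residual invariants of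
inertia lift to invariants modulo `π`, then all unramified classes are in the image of the
connecting map. -/
theorem H1ur_le_range_deltaDual (hΦ : IsGeomFrob p K Φ) (hρ : IsContRep p ρ)
    (hψ : IsContRep p (charRep ψ))
    (hres : ∀ g, IsLocalRing.residue (integers p F) (ψ g) = 1)
    (hunr : ∀ g ∈ inertia p K, ψ g = 1) {c m : integers p F} (hc : c ≠ 0)
    (hm : m ∈ IsLocalRing.maximalIdeal (integers p F)) {T : Module.End (integers p F) X}
    (hT : ((ψ Φ : integers p F) • ρ Φ - 1) * T = c • 1)
    (hTI : ∀ x, (∀ g ∈ inertia p K, ∃ z, ρ g x - x = (c * m) • z) →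
      ∀ g ∈ inertia p K, ∃ z, ρ g (T x) - T x = (c * m) • z)
    (hlift : ∀ a : X, (∀ g ∈ inertia p K, ρ g a ⊗ₜ[integers p F] (1 : resField p F) = a ⊗ₜ 1) →
      ∃ a' : X, a' ⊗ₜ[integers p F] (1 : resField p F) = a ⊗ₜ 1 ∧
        ∀ g ∈ inertia p K, ∃ z, ρ g a' - a' = (c * m) • z) :
    H1ur p (tensorTriv ρ (resField p F)) ≤ LinearMap.range (deltaDual hρ hψ hres) := by
  intro κ hκ
  obtain ⟨z, rfl⟩ := Submodule.Quotient.mk_surjective _ κ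
  obtain ⟨e, he⟩ := (mk_mem_H1ur_iff z).1 hκ
  let D := connectingData hρ hψ hres
  let w : Z1 (tensorTriv ρ (resField p F)) := z - coboundary hρ e
  have hwI : ∀ g ∈ inertia p K, w.1 g = 0 := fun g hg => sub_eq_zero.2 (he g hg)
  -- Compare the cocycle relation for `g * Φ` with that for `Φ * (Φ⁻¹ * g * Φ)`; inertia is normal
  -- and `w` vanishes on it.
  have hwinv : ∀ g ∈ inertia p K, tensorTriv ρ (resField p F) g (w.1 Φ) = w.1 Φ := fun g hg => by
    have h1 := w.2.2 g Φ
    have h2 := w.2.2 Φ (Φ⁻¹ * g * Φ)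
    have h3 : Φ⁻¹ * g * Φ ∈ inertia p K := by
      simpa using inertia_normal.conj_mem g hg Φ⁻¹
    have h4 : Φ * (Φ⁻¹ * g * Φ) = g * Φ := by group
    rw [h4, hwI _ h3, map_zero, add_zero] at h2
    rw [hwI g hg, zero_add] at h1
    exact h1.symm.trans h2
  obtain ⟨a, ha⟩ := exists_tmul_one_eq (w.1 Φ)
  obtain ⟨x, hxa, hx⟩ := hlift a fun g hg => by
    rw [← tensorTriv_tmul_one, ha]
    exact hwinv g hg
  let r := TensorProduct.rid (integers p F) X
  let y := r.symm (T x)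
  -- The preimage is `T x / c`, since `ψ Φ ρ(Φ) - 1` sends `T x` to `c x`.
  let b : (X ⊗[integers p F] (integers p F)) ⊗[integers p F] F := y ⊗ₜ (c : F)⁻¹
  have hyΦ : twist ρ ψ Φ y - y = c • r.symm x := by
    apply r.injective
    have h1 := LinearMap.congr_fun hT x
    simp only [Module.End.mul_apply, LinearMap.sub_apply, LinearMap.smul_apply,
      Module.End.one_apply] at h1
    rw [map_sub, rid_twist, map_smul, LinearEquiv.apply_symm_apply, LinearEquiv.apply_symm_apply,
      h1]
  have hyI : ∀ g ∈ inertia p K, ∃ v, twist ρ ψ g y - y = c • r.symm (m • v) := fun g hg => by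
    obtain ⟨v, hv⟩ := hTI x hx g hg
    refine ⟨v, r.injective ?_⟩
    rw [map_sub, rid_twist, map_smul, LinearEquiv.apply_symm_apply, LinearEquiv.apply_symm_apply,
      hunr g hg, Units.val_one, one_smul, hv, smul_smul]
  have hinv : ∀ g v, twist ρ ψ g y - y = c • v →
      g ∈ stab (tensorTriv (twist ρ ψ) (FmodO p F)) (toFmodO p _ b) := fun g v hv =>
    D.mem_stab (tensorTriv_twist_sub_eq hc hv)
  -- Some power of `p` is a multiple of `c`, so for `g` near `1` continuity makes `g y - y`
  -- divisible by `c`.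
  have hopen : IsOpen (stab (tensorTriv (twist ρ ψ) (FmodO p F)) (toFmodO p _ b) :
      Set (absGal K)) := by
    refine Subgroup.isOpen_of_mem_nhds _ (g := 1) ?_
    obtain ⟨n, d, hd⟩ := exists_pow_smul p (c : F)⁻¹
    have hd' : (p : integers p F) ^ n = c * d := Subtype.ext (by
      have hc' : (c : F) ≠ 0 := fun h0 => hc (Subtype.ext h0)
      change (p : F) ^ n = c * d
      rw [← hd]
      field_simp)
    filter_upwards [twist_eventually hρ hψ y n 1] with g ⟨v, hv⟩
    rw [map_one, Module.End.one_apply, hd', mul_smul] at hv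
    exact hinv g _ hv
  have htop := eq_top_of_isOpen hΦ hopen
    (fun g hg => (hyI g hg).elim fun v hv => hinv g _ hv) (hinv Φ _ hyΦ)
  have hb : toFmodO p _ b ∈ (tensorTriv (twist ρ ψ) (FmodO p F)).invariants :=
    fun g => mem_stab.1 (htop ▸ Subgroup.mem_top g)
  have hw : D.cocycle b hb = w := by
    refine Z1_ext hΦ (fun g hg => ?_) ?_
    · obtain ⟨v, hv⟩ := hyI g hg
      rw [D.cocycle_eq b hb g _ (tensorTriv_twist_sub_eq hc hv), reduction_eq,
        LinearEquiv.apply_symm_apply, smul_tmul_one_eq_zero hm, hwI g hg]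
    · rw [D.cocycle_eq b hb Φ _ (tensorTriv_twist_sub_eq hc hyΦ), reduction_eq,
        LinearEquiv.apply_symm_apply, hxa, ha]
  refine ⟨⟨_, hb⟩, ?_⟩
  have hdelta : deltaDual hρ hψ hres ⟨_, hb⟩ = Submodule.Quotient.mk (D.cocycle b hb) :=
    D.delta_eq ⟨_, hb⟩ b rfl
  rw [hdelta, hw, Submodule.Quotient.eq]
  refine ⟨-e, fun g => ?_⟩
  change z.1 g - (tensorTriv ρ (resField p F) g e - e) - z.1 g = _
  rw [map_neg]
  abel

/-- The image of the connecting map is the space of unramified classes. -/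
theorem range_deltaDual_eq [Module.Finite (integers p F) X] (hΦ : IsGeomFrob p K Φ)
    (hρ : IsContRep p ρ) (hψ : IsContRep p (charRep ψ)) (hunr : ∀ g ∈ inertia p K, ψ g = 1)
    {E : IntermediateField ℚ_[p] F} (hreal : IsRealisableOver (integers p E) ρ)
    {ϖ : integers p E} (hϖ : Irreducible ϖ)
    (hv₀ : 0 < normalizedVal p ((ϖ : E) : F) (((ψ Φ : integers p F) : F) - 1))
    (hv₁ : Module.finrank (integers p F) X *
      normalizedVal p ((ϖ : E) : F) (((ψ Φ : integers p F) : F) - 1) < 1) :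
    ∃ hres : ∀ g, IsLocalRing.residue (integers p F) (ψ g) = 1,
      LinearMap.range (deltaDual hρ hψ hres) = H1ur p (tensorTriv ρ (resField p F)) := by
  obtain ⟨n, ρ₀, e, he⟩ := hreal
  have hn : Module.finrank (integers p F) X = n := by
    rw [← e.finrank_eq, Module.finrank_baseChange, Module.finrank_fin_fun]
  let π : integers p F := algebraMap (integers p E) (integers p F) ϖ
  have hspan := span_irreducible_isMaximal hϖ
  have hπ0 : π ≠ 0 := fun h => hϖ.ne_zero
    (Subtype.ext ((algebraMap E F).injective ((congrArg Subtype.val h).trans (map_zero _).symm)))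
  have hπ : π ∈ IsLocalRing.maximalIdeal (integers p F) := by
    rw [mem_maximalIdeal_integers_iff]
    have h1 : ϖ ∈ IsLocalRing.maximalIdeal (integers p E) := hϖ.not_isUnit
    rw [mem_maximalIdeal_integers_iff,
      spectralNorm.eq_of_tower (K := ℚ_[p]) (E := E) (L := F)] at h1
    exact h1
  rw [hn] at hv₁
  obtain ⟨hu, hun⟩ := mem_maximalIdeal_and_not_dvd_pow_of_normalizedVal (π := π)
    (u := (ψ Φ : integers p F) - 1) (n := n) hπ0 hπ hv₀ hv₁
  have hres := residue_eq_one_of_unramified hΦ hψ hunr hu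
  refine ⟨hres, ?_⟩
  obtain ⟨c, q, hcπ, hT₁, hT₂⟩ := exists_aeval_mul_eq_smul hspan e (fun a x => he Φ a x) (ψ Φ)
    hu hun
  obtain ⟨m, hm, hcm⟩ := exists_eq_mul_of_not_dvd hcπ
  have hc : c ≠ 0 := fun h => hπ0 (by
    change algebraMap (integers p E) (integers p F) ϖ = 0
    rw [hcm, h, zero_mul])
  -- Used for `J = (c)` in one inclusion and for `J` the maximal ideal in the other.
  have hlift : ∀ (J : Ideal (integers p F)), π ∈ J → ∀ a : X,
      (∀ g ∈ inertia p K, ρ g a - a ∈ J • (⊤ : Submodule (integers p F) X)) →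
      ∃ a', a - a' ∈ J • (⊤ : Submodule (integers p F) X) ∧
        ∀ g ∈ inertia p K, ∃ z, ρ g a' - a' = (c * m) • z := fun J hJ a haJ => by
    obtain ⟨a', h1, h2⟩ := exists_sub_mem_forall_eq_smul hspan hJ e
      (fun g : inertia p K => ρ₀ g - 1) (fun g => ρ g - 1)
      (fun g a x => by
        rw [LinearMap.sub_apply, LinearMap.sub_apply, TensorProduct.tmul_sub, map_sub, he]
        rfl) a (fun g => haJ g g.2)
    refine ⟨a', h1, fun g hg => ?_⟩
    rw [← hcm]
    exact h2 ⟨g, hg⟩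
  have hπc : π ∈ Ideal.span {c} := Ideal.mem_span_singleton.2 ⟨m, hcm⟩
  refine le_antisymm (range_deltaDual_le hρ hψ hres hunr hc hm hT₂ fun a ha => ?_)
    (H1ur_le_range_deltaDual hΦ hρ hψ hres hunr hc hm hT₁ (fun x hx => ?_) fun a ha => ?_)
  · obtain ⟨a', h1, h2⟩ := hlift _ hπc a fun g hg => by
      obtain ⟨z, hz⟩ := ha g hg
      rw [hz]
      exact Submodule.smul_mem_smul (Ideal.mem_span_singleton_self c) trivial
    rw [Submodule.ideal_span_singleton_smul] at h1
    obtain ⟨y, -, hy⟩ := (Submodule.mem_smul_pointwise_iff_exists _ _ _).1 h1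
    refine ⟨y, ?_⟩
    rwa [hy, sub_sub_cancel]
  -- The vectors invariant under inertia modulo `π` form a submodule stable under `ρ Φ`, by
  -- normality of inertia, hence under every polynomial in `ρ Φ`, in particular `T`.
  · let P : Submodule (integers p F) X :=
      { carrier := {x | ∀ g ∈ inertia p K, ∃ z, ρ g x - x = (c * m) • z}
        zero_mem' := fun g _ => ⟨0, by simp⟩
        add_mem' := fun {x y} hx hy g hg => by
          obtain ⟨s, hs⟩ := hx g hg
          obtain ⟨t, ht⟩ := hy g hg
          refine ⟨s + t, ?_⟩
          rw [smul_add, ← hs, ← ht, map_add]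
          abel
        smul_mem' := fun s x hx g hg => by
          obtain ⟨t, ht⟩ := hx g hg
          refine ⟨s • t, ?_⟩
          rw [smul_comm, ← ht, map_smul, smul_sub] }
    refine Polynomial.aeval_apply_smul_mem_of_le_comap (q := P) (m := x) hx q (ρ Φ)
      fun v hv g hg => ?_
    obtain ⟨t, ht⟩ := hv (Φ⁻¹ * g * Φ) (by simpa using inertia_normal.conj_mem g hg Φ⁻¹)
    refine ⟨ρ Φ t, ?_⟩
    rw [← map_smul, ← ht, map_sub, ← Module.End.mul_apply, ← Module.End.mul_apply, ← map_mul,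
      ← map_mul]
    have e : Φ * (Φ⁻¹ * g * Φ) = g * Φ := by group
    rw [e]
  · obtain ⟨a', h1, h2⟩ := hlift _ hπ a fun g hg => by
      rw [← tmul_one_eq_zero_iff, TensorProduct.sub_tmul, ha g hg, sub_self]
    refine ⟨a', ?_, h2⟩
    rw [← tmul_one_eq_zero_iff, TensorProduct.sub_tmul, sub_eq_zero] at h1
    exact h1.symm

end Image

end GalTwist

end

theorem mainTheorem10 (p : ℕ) [Fact p.Prime]
    {K : Type*} [Field K] [Algebra ℚ_[p] K] [FiniteDimensional ℚ_[p] K]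
    (Frob : GalTwist.absGal K) (hFrob : GalTwist.IsGeomFrob p K Frob)
    -- the coefficient field `F`, the lattice `X` and the unramified character `ψ`
    {F : Type*} [Field F] [Algebra ℚ_[p] F] [FiniteDimensional ℚ_[p] F]
    {X : Type*} [AddCommGroup X] [Module (GalTwist.integers p F) X]
    [Module.Free (GalTwist.integers p F) X] [Module.Finite (GalTwist.integers p F) X]
    (ρ : Representation (GalTwist.integers p F) (GalTwist.absGal K) X)
    (hρ : GalTwist.IsContRep p ρ)
    (ψ : GalTwist.absGal K →* (GalTwist.integers p F)ˣ)
    (hψ : GalTwist.IsContRep p (GalTwist.charRep ψ))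
    (hunr : ∀ g ∈ GalTwist.inertia p K, ψ g = 1)
    -- the subfield `E` with uniformiser `ϖ`
    (E : IntermediateField ℚ_[p] F)
    (hreal : GalTwist.IsRealisableOver (GalTwist.integers p E) ρ)
    (he : Module.finrank (GalTwist.integers p F) X <
      (IsLocalRing.maximalIdeal (GalTwist.integers p F)).ramificationIdx (GalTwist.integers p E))
    (ϖ : GalTwist.integers p E) (hϖ : Irreducible ϖ)
    (hv₀ : 0 < GalTwist.normalizedVal p ((ϖ : E) : F)
      (((ψ Frob : GalTwist.integers p F) : F) - 1))
    (hv₁ : Module.finrank (GalTwist.integers p F) X * GalTwist.normalizedVal p ((ϖ : E) : F)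
      (((ψ Frob : GalTwist.integers p F) : F) - 1) < 1)
    (hinv : (GalTwist.twist ρ ψ).invariants = ⊥) :
    ∃ hres : ∀ g, IsLocalRing.residue (GalTwist.integers p F) (ψ g) = 1,
      LinearMap.range (GalTwist.deltaDual hρ hψ hres) =
        GalTwist.H1ur p (GalTwist.tensorTriv ρ (GalTwist.resField p F)) ∧
      -- the image depends only on the `G_K`-module `X ⊗ 𝔽`: it corresponds to the image for any
      -- other choice of `F`, `X`, `ψ` as above under any isomorphism of the reductions
      ∀ (F' : Type*) [Field F'] [Algebra ℚ_[p] F'] [FiniteDimensional ℚ_[p] F']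
        (X' : Type*) [AddCommGroup X'] [Module (GalTwist.integers p F') X']
        [Module.Free (GalTwist.integers p F') X'] [Module.Finite (GalTwist.integers p F') X']
        (ρ' : Representation (GalTwist.integers p F') (GalTwist.absGal K) X')
        (hρ' : GalTwist.IsContRep p ρ')
        (ψ' : GalTwist.absGal K →* (GalTwist.integers p F')ˣ)
        (hψ' : GalTwist.IsContRep p (GalTwist.charRep ψ'))
        (_ : ∀ g ∈ GalTwist.inertia p K, ψ' g = 1)
        (E' : IntermediateField ℚ_[p] F')
        (_ : GalTwist.IsRealisableOver (GalTwist.integers p E') ρ')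
        (_ : Module.finrank (GalTwist.integers p F') X' <
          (IsLocalRing.maximalIdeal (GalTwist.integers p F')).ramificationIdx
            (GalTwist.integers p E'))
        (ϖ' : GalTwist.integers p E') (_ : Irreducible ϖ')
        (_ : 0 < GalTwist.normalizedVal p ((ϖ' : E') : F')
          (((ψ' Frob : GalTwist.integers p F') : F') - 1))
        (_ : Module.finrank (GalTwist.integers p F') X' *
          GalTwist.normalizedVal p ((ϖ' : E') : F')
            (((ψ' Frob : GalTwist.integers p F') : F') - 1) < 1)
        (_ : (GalTwist.twist ρ' ψ').invariants = ⊥)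
        (hres' : ∀ g, IsLocalRing.residue (GalTwist.integers p F') (ψ' g) = 1)
        (φ : TensorProduct (GalTwist.integers p F) X (GalTwist.resField p F) ≃+
          TensorProduct (GalTwist.integers p F') X' (GalTwist.resField p F'))
        (hφ : ∀ g m, φ.toAddMonoidHom (GalTwist.tensorTriv ρ (GalTwist.resField p F) g m) =
          GalTwist.tensorTriv ρ' (GalTwist.resField p F') g (φ.toAddMonoidHom m)),
        (LinearMap.range (GalTwist.deltaDual hρ hψ hres)).toAddSubgroup.map
            (GalTwist.H1map _ _ φ.toAddMonoidHom hφ) =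
          (LinearMap.range (GalTwist.deltaDual hρ' hψ' hres')).toAddSubgroup := by
  obtain ⟨hres, h⟩ :=
    GalTwist.range_deltaDual_eq hFrob hρ hψ hunr hreal hϖ hv₀ hv₁
  refine ⟨hres, h, ?_⟩
  intro F' _ _ _ X' _ _ _ _ ρ' hρ' ψ' hψ' hunr' E' hreal' _ ϖ' hϖ' hv₀' hv₁' _ hres' φ hφ
  obtain ⟨_, h'⟩ := GalTwist.range_deltaDual_eq hFrob hρ' hψ' hunr' hreal' hϖ' hv₀' hv₁'
  -- Both images are now the unramified subspaces, which depend only on the residual Galois modules.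
  rw [h, h']
  exact GalTwist.H1ur_map_eq φ hφ
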